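/- Let $S>0$. For real-valued $q\in L^2(\mathbb R)$ vanishing a.e. outside $[-S,S]$ and a real $2\times2$ matrix $M$ with $\det M=1$, consider $$-y''+qy=\zeta^2y\quad\text{on }(-\infty,0)\cup(0,\infty),\qquad \begin{pmatrix}y(0^+)\\ y'(0^+)\end{pmatrix}=M\begin{pmatrix}y(0^-)\\ y'(0^-)\end{pmatrix}.\tag{1}$$ (On each half-line solutions are taken in the Carathéodory sense: $y'$ is locally absolutely continuous and the equation holds a.e.) For real $\xi\ne0$ let $f_{\pm}(\cdot,\xi)$ be the Jost solutions, i.e. the solutions of (1) with $\zeta=\xi$ such that $e^{-i\xi x}f_+(x,\xi)\to1$ as $x\to\infty$ and $e^{i\xi x}f_-(x,\xi)\to1$ as $x\to-\infty$. Write $f_-(x,\xi)=A(\xi)f_+(x,-\xi)+B(\xi)f_+(x,\xi)$ for $x\neq 0$, and let $R(\xi)=B(\xi)/A(\xi)$, $\xi\in\mathbb R\setminus\{0\}$, be the reflection coefficient. The eigenvalues of (1) are the numbers $\lambda=\zeta^2\in\mathbb C$ for which (1) has a nontrivial solution in $L^2(\mathbb R)$. The scattering data of $(q,M)$ consist of the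 function $R$ and the eigenvalues of (1). On $[-S,S]$ consider $-y''+qy=\lambda y$ with the same potential $q|_{[-S,S]}$ and the same transfer condition at $0$. The Neumann–Neumann spectrum is the set of $\lambda\in\mathbb C$ for which there is a nontrivial solution with $y'(-S)=0=y'(S)$. The Neumann–Dirichlet spectrum is the set of $\lambda\in\mathbb C$ for which there is a nontrivial solution with $y'(-S)=0=y(S)$. The norming constant of a Neumann–Neumann eigenvalue $\lambda$ is $\int_{-S}^{S}w(x,\lambda)^2\,dx$, where $w(\cdot,\lambda)$ is the solution of the equation and the transfer condition with $w(-S,\lambda)=1$, $w'(-S,\lambda)=0$. **Theorem.** For given $S$, the scattering data of $(q,M)$ uniquely determine the Neumann–Neumann spectrum, the Neumann–Dirichlet spectrum and the Neumann–Neumann norming constants of $(q,M)$ on $[-S,S]$. That is, if $(q_1,M_1)$ and $(q_2,M_2)$ are as above, with $q_1,q_2$ both vanishing a.e. outside $[-S,S]$, and have the same reflection coefficient on $\mathbb R\setminus\{0\}$ and the same eigenvalues on the line, then their Neumann–Neumann spectra on $[-S,S]$ coincide, their Neumann–Dirichlet spectra on $[-S,S]$ coincide, and at every Neumann–Neumann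 eigenvalue their norming constants coincide. -/

import Mathlib

open Filter Topology MeasureTheory

namespace TransferSL

/-- `y`, with derivative `dy`, is a (Carathéodory) solution of `-y'' + q y = lam y` on the
interval `I`: `y` is differentiable on `I` with derivative `dy` (one-sided at end-points that
belong to `I`), `dy` is locally absolutely continuous on `I`, and the equation holds almost
everywhere on `I`. -/
structure IsSolutionOn (q : ℝ → ℝ) (lam : ℂ) (I : Set ℝ) (y dy : ℝ → ℂ) : Prop where
  hasDeriv : ∀ x ∈ I, HasDerivWithinAt y (dy x) I x
  absCont : ∀ a ∈ I, ∀ b ∈ I, AbsolutelyContinuousOnInterval dy a b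
  eqn : ∀ᵐ x : ℝ, x ∈ I → HasDerivAt dy (((q x : ℂ) - lam) * y x) x

/-- The transfer condition at the origin: the one-sided limits of `y` and `dy` at `0` exist and
`(y(0⁺), y'(0⁺))ᵀ = M (y(0⁻), y'(0⁻))ᵀ`. -/
def TransferCondition (M : Matrix (Fin 2) (Fin 2) ℝ) (y dy : ℝ → ℂ) : Prop :=
  ∃ l r l' r' : ℂ,
    Tendsto y (𝓝[<] 0) (𝓝 l) ∧ Tendsto dy (𝓝[<] 0) (𝓝 l') ∧
    Tendsto y (𝓝[>] 0) (𝓝 r) ∧ Tendsto dy (𝓝[>] 0) (𝓝 r') ∧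
    r = (M 0 0 : ℂ) * l + (M 0 1 : ℂ) * l' ∧
    r' = (M 1 0 : ℂ) * l + (M 1 1 : ℂ) * l'

/-- `y`, with derivative `dy`, solves `-y'' + q y = lam y` on `J ∖ {0}`, that is, on each of the
two pieces of the interval `J` on either side of the origin, and obeys the transfer condition
at the origin. The values of `y` and `dy` at `0` itself are irrelevant. -/
structure IsTransferSolution (q : ℝ → ℝ) (M : Matrix (Fin 2) (Fin 2) ℝ) (lam : ℂ) (J : Set ℝ)
    (y dy : ℝ → ℂ) : Prop where
  left : IsSolutionOn q lam (J ∩ Set.Iio 0) y dy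
  right : IsSolutionOn q lam (J ∩ Set.Ioi 0) y dy
  transfer : TransferCondition M y dy

/-! ### The problem on the line -/

/-- The eigenvalues `lam = ζ ^ 2` of the problem on the line: there is a nontrivial
square-integrable solution on `(-∞, 0) ∪ (0, ∞)` obeying the transfer condition. -/
def lineEigenvalues (q : ℝ → ℝ) (M : Matrix (Fin 2) (Fin 2) ℝ) : Set ℂ :=
  {lam | ∃ y dy : ℝ → ℂ, IsTransferSolution q M lam Set.univ y dy ∧
    MemLp y 2 volume ∧ ∃ x : ℝ, x ≠ 0 ∧ y x ≠ 0}

/-- `f` is the Jost solution `f_{+,M}(·, ξ)`, for real `ξ`: `e^{-iξx} f(x) → 1` as `x → ∞`. -/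
def IsJostPlus (q : ℝ → ℝ) (M : Matrix (Fin 2) (Fin 2) ℝ) (ξ : ℝ) (f : ℝ → ℂ) : Prop :=
  (∃ df : ℝ → ℂ, IsTransferSolution q M ((ξ : ℂ) ^ 2) Set.univ f df) ∧
    Tendsto (fun x : ℝ => Complex.exp (-(Complex.I * ξ * x)) * f x) atTop (𝓝 1)

/-- `f` is the Jost solution `f_{-,M}(·, ξ)`, for real `ξ`: `e^{iξx} f(x) → 1` as `x → -∞`. -/
def IsJostMinus (q : ℝ → ℝ) (M : Matrix (Fin 2) (Fin 2) ℝ) (ξ : ℝ) (f : ℝ → ℂ) : Prop :=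
  (∃ df : ℝ → ℂ, IsTransferSolution q M ((ξ : ℂ) ^ 2) Set.univ f df) ∧
    Tendsto (fun x : ℝ => Complex.exp (Complex.I * ξ * x) * f x) atBot (𝓝 1)

/-- `A`, `B` are the coefficients `A(ξ)`, `B(ξ)` in
`f_{-,M}(x, ξ) = A(ξ) f_{+,M}(x, -ξ) + B(ξ) f_{+,M}(x, ξ)`; here `f_{+,M}(x, -ξ)` is the
conjugate Jost solution. -/
def IsScatteringPair (q : ℝ → ℝ) (M : Matrix (Fin 2) (Fin 2) ℝ) (ξ : ℝ) (A B : ℂ) : Prop :=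
  ∃ fm fp fpc : ℝ → ℂ, IsJostMinus q M ξ fm ∧ IsJostPlus q M ξ fp ∧ IsJostPlus q M (-ξ) fpc ∧
    ∀ x : ℝ, x ≠ 0 → fm x = A * fpc x + B * fp x

open Classical in
/-- The reflection coefficient `R(ξ) = B(ξ) / A(ξ)`, for real `ξ ≠ 0`. For a compactly supported
square-integrable `q` and `det M = 1`, the pair `A(ξ)`, `B(ξ)` exists, is unique, and has
`A(ξ) ≠ 0`. -/
noncomputable def reflectionCoeff (q : ℝ → ℝ) (M : Matrix (Fin 2) (Fin 2) ℝ) (ξ : ℝ) : ℂ :=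
  if h : ∃ r A B : ℂ, IsScatteringPair q M ξ A B ∧ r = B / A then h.choose else 0

/-! ### The problem on the interval `[-S, S]` -/

/-- The spectrum (set of eigenvalues) of the problem on `[-S, S]` with the boundary conditions
`y(-S) cos α - y'(-S) sin α = 0` and `y(S) cos β - y'(S) sin β = 0`. -/
def intervalSpectrum (q : ℝ → ℝ) (M : Matrix (Fin 2) (Fin 2) ℝ) (S α β : ℝ) : Set ℂ :=
  {lam | ∃ y dy : ℝ → ℂ, IsTransferSolution q M lam (Set.Icc (-S) S) y dy ∧
    y (-S) * (Real.cos α : ℂ) - dy (-S) * (Real.sin α : ℂ) = 0 ∧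
    y S * (Real.cos β : ℂ) - dy S * (Real.sin β : ℂ) = 0 ∧
    ∃ x ∈ Set.Icc (-S) S, x ≠ 0 ∧ y x ≠ 0}

/-- The Neumann–Neumann spectrum: `y'(-S) = 0 = y'(S)`, i.e. `α = β = π/2`. -/
noncomputable def neumannNeumannSpectrum (q : ℝ → ℝ) (M : Matrix (Fin 2) (Fin 2) ℝ) (S : ℝ) :
    Set ℂ :=
  intervalSpectrum q M S (Real.pi / 2) (Real.pi / 2)

/-- The Neumann–Dirichlet spectrum: `y'(-S) = 0 = y(S)`, i.e. `α = π/2`, `β = π`. -/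
noncomputable def neumannDirichletSpectrum (q : ℝ → ℝ) (M : Matrix (Fin 2) (Fin 2) ℝ) (S : ℝ) :
    Set ℂ :=
  intervalSpectrum q M S (Real.pi / 2) Real.pi

/-- `a = ∫_{-S}^{S} w_α(x, lam)² dx`, where `w_α(·, lam)` is the solution on `[-S, S]` with
`w_α(-S) = sin α`, `w_α'(-S) = cos α`. -/
def IsNormingConstant (q : ℝ → ℝ) (M : Matrix (Fin 2) (Fin 2) ℝ) (S α : ℝ) (lam a : ℂ) : Prop :=
  ∃ w dw : ℝ → ℂ, IsTransferSolution q M lam (Set.Icc (-S) S) w dw ∧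
    w (-S) = (Real.sin α : ℂ) ∧ dw (-S) = (Real.cos α : ℂ) ∧
    a = ∫ x in (-S)..S, w x ^ 2

open Classical in
/-- The norming constant associated with `lam`: the number `∫_{-S}^{S} w_α(x, lam)² dx`. It
exists and is unique for square-integrable `q` and `S > 0`. -/
noncomputable def normingConstant (q : ℝ → ℝ) (M : Matrix (Fin 2) (Fin 2) ℝ) (S α : ℝ)
    (lam : ℂ) : ℂ :=
  if h : ∃ a : ℂ, IsNormingConstant q M S α lam a then h.choose else 0

/-- The norming constants of the Neumann–Neumann problem (`α = π/2`). -/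
noncomputable def neumannNeumannNormingConstant (q : ℝ → ℝ) (M : Matrix (Fin 2) (Fin 2) ℝ)
    (S : ℝ) (lam : ℂ) : ℂ :=
  normingConstant q M S (Real.pi / 2) lam

end TransferSL

namespace TransferSL

/-! ### Absolutely continuous functions -/

/-! Outside [-S, S] every solution is a combination of exponentials, so the scattering data can be
read off at S from the solution with data (1, -iζ) at -S, a multiple of f₋. If (z, z') are its data
at S, then P = iζz - z' and Q = iζz + z' are A and B up to elementary factors. Thus R is e^{-2iξS}
Q/P, and for Im ζ > 0 the number ζ² is an eigenvalue exactly when P(ζ) = 0 (`reflectionCoeff_eq`,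
`sq_mem_lineEigenvalues_iff`).

The main point is that the data determine the entire function P up to a constant. On the real axis
|P|² - |Q|² = 4ξ², so R determines |P|. In the closed upper half-plane the zeros of P are simple
(`deriv_P_ne_zero`), and P has the size of a power of ζ times an elementary factor
(`exists_P_growth`). For two problems with the same data, P₁/P₂ and P₂/P₁ are therefore holomorphic
and bounded in the upper half-plane, with modulus one on the real axis. Phragmén–Lindelöf bounds
both by one, and the maximum principle gives P₁ = kP₂ (`exists_eq_const_mul`,
`exists_P_eq_const_mul`).

Then Q₁ = kQ₂ on the real axis as well. The parts even and odd in ξ show that the whole monodromy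
matrix from -S to S is multiplied by k; its determinant is one, so k² = 1 (`exists_sign`). The sign
is a true ambiguity, since M and -M have the same scattering data, but it is harmless: the two
interval spectra are the zero sets of entries of the monodromy matrix, and the norming constants are
limits of Lagrange quotients quadratic in those entries.

The transfer condition is handled by pairs of solutions on the whole line, matched at the origin.
Their existence, uniqueness and analytic dependence on the spectral parameter come from Volterra
operators in a weighted norm. -/

theorem absolutelyContinuousOnInterval_of_dist_le {X Y : Type*} [PseudoMetricSpace X]
    [PseudoMetricSpace Y] {f : ℝ → X} {g : ℝ → Y} {a b : ℝ} (C : ℝ)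
    (hg : AbsolutelyContinuousOnInterval g a b)
    (h : ∀ x ∈ Set.uIcc a b, ∀ y ∈ Set.uIcc a b, dist (f x) (f y) ≤ C * dist (g x) (g y)) :
    AbsolutelyContinuousOnInterval f a b := by
  unfold AbsolutelyContinuousOnInterval at hg ⊢
  refine squeeze_zero' ?_ ?_ (by simpa using hg.const_mul C)
  · exact Eventually.of_forall fun _ => Finset.sum_nonneg fun _ _ => dist_nonneg
  · refine eventually_inf_principal.mpr (Eventually.of_forall fun E hE => ?_)
    rw [Finset.mul_sum]
    exact Finset.sum_le_sum fun i hi => h _ (hE.1 i hi).1 _ (hE.1 i hi).2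

theorem absolutelyContinuousOnInterval_integral {E : Type*} [NormedAddCommGroup E]
    [NormedSpace ℝ E] {g : ℝ → E} {a b c : ℝ} (h : IntervalIntegrable g volume a b)
    (hc : c ∈ Set.uIcc a b) :
    AbsolutelyContinuousOnInterval (fun x => ∫ v in c..x, g v) a b := by
  refine absolutelyContinuousOnInterval_of_dist_le 1
    (h.norm.absolutelyContinuousOnInterval_intervalIntegral hc) fun x hx y hy => ?_
  have hi : ∀ u ∈ Set.uIcc a b, ∀ v ∈ Set.uIcc a b, IntervalIntegrable g volume u v :=
    fun u hu v hv => h.mono_set (Set.uIcc_subset_uIcc hu hv)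
  rw [one_mul, dist_eq_norm, dist_eq_norm,
    intervalIntegral.integral_interval_sub_left (hi _ hc _ hx) (hi _ hc _ hy),
    intervalIntegral.integral_interval_sub_left (hi _ hc _ hx).norm (hi _ hc _ hy).norm]
  exact intervalIntegral.norm_integral_le_abs_integral_norm

/-- The difference of f and the primitive of g is absolutely continuous with derivative zero almost
everywhere, hence constant. Derivatives of Carathéodory solutions require the fundamental theorem in
this generality. -/
theorem integral_eq_sub_of_absolutelyContinuousOnInterval {E : Type*} [NormedAddCommGroup E]
    [NormedSpace ℝ E] [CompleteSpace E] {f g : ℝ → E} {a b : ℝ}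
    (hf : AbsolutelyContinuousOnInterval f a b) (hg : IntervalIntegrable g volume a b)
    (hd : ∀ᵐ x : ℝ, x ∈ Set.uIcc a b → HasDerivAt f (g x) x) :
    ∫ x in a..b, g x = f b - f a := by
  have h0 := hf.sub (absolutelyContinuousOnInterval_integral hg Set.left_mem_uIcc)
  obtain ⟨C, hC⟩ := h0.const_of_ae_hasDerivAt_zero (by
    filter_upwards [hd, hg.ae_hasDerivAt_integral] with x h1 h2 h3
    have := (h1 h3).sub (h2 h3 a Set.left_mem_uIcc)
    rwa [sub_self] at this)
  have ha := hC a Set.left_mem_uIcc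
  have hb := hC b Set.right_mem_uIcc
  simp only [Pi.sub_apply, intervalIntegral.integral_same, sub_zero] at ha hb
  rw [ha, ← hb]; abel

theorem ae_ne_real (a : ℝ) : ∀ᵐ x : ℝ, x ≠ a := by
  simp [ae_iff, measure_singleton]

theorem _root_.IntervalIntegrable.complexOfReal {q : ℝ → ℝ} {a b : ℝ}
    (h : IntervalIntegrable q volume a b) : IntervalIntegrable (fun x => (q x : ℂ)) volume a b :=
  ⟨h.1.ofReal, h.2.ofReal⟩

/-! ### Solutions -/

theorem IsSolutionOn.mono {q : ℝ → ℝ} {lam : ℂ} {I J : Set ℝ} {y dy : ℝ → ℂ}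
    (h : IsSolutionOn q lam I y dy) (hJ : J ⊆ I) : IsSolutionOn q lam J y dy where
  hasDeriv x hx := (h.hasDeriv x (hJ hx)).mono hJ
  absCont a ha b hb := h.absCont a (hJ ha) b (hJ hb)
  eqn := by filter_upwards [h.eqn] with x hx hxJ using hx (hJ hxJ)

theorem IsSolutionOn.continuousOn_deriv {q : ℝ → ℝ} {lam : ℂ} {a b : ℝ} {y dy : ℝ → ℂ}
    (h : IsSolutionOn q lam (Set.uIcc a b) y dy) : ContinuousOn dy (Set.uIcc a b) :=
  (h.absCont a Set.left_mem_uIcc b Set.right_mem_uIcc).continuousOn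

theorem IsSolutionOn.continuousOn {q : ℝ → ℝ} {lam : ℂ} {I : Set ℝ} {y dy : ℝ → ℂ}
    (h : IsSolutionOn q lam I y dy) : ContinuousOn y I :=
  fun x hx => (h.hasDeriv x hx).continuousWithinAt

theorem IsSolutionOn.absCont_self {q : ℝ → ℝ} {lam : ℂ} {a b : ℝ} {y dy : ℝ → ℂ}
    (h : IsSolutionOn q lam (Set.uIcc a b) y dy) : AbsolutelyContinuousOnInterval y a b := by
  obtain ⟨C, hC⟩ := isCompact_uIcc.exists_bound_of_continuousOn h.continuousOn_deriv
  refine LipschitzOnWith.absolutelyContinuousOnInterval (K := C.toNNReal) ?_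
  refine (convex_uIcc a b).lipschitzOnWith_of_nnnorm_hasDerivWithin_le h.hasDeriv fun x hx => ?_
  rw [← NNReal.coe_le_coe, coe_nnnorm]
  exact (hC x hx).trans (Real.le_coe_toNNReal C)

/-- The Lagrange identity for solutions of two equations. -/
theorem IsSolutionOn.wronskian {q p : ℝ → ℝ} {lam mu : ℂ} {a b : ℝ} {y dy z dz : ℝ → ℂ}
    (hq : IntervalIntegrable q volume a b) (hp : IntervalIntegrable p volume a b)
    (hy : IsSolutionOn q lam (Set.uIcc a b) y dy) (hz : IsSolutionOn p mu (Set.uIcc a b) z dz) :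
    ∫ x in a..b, ((p x : ℂ) - q x + (lam - mu)) * (y x * z x) =
      (y b * dz b - dy b * z b) - (y a * dz a - dy a * z a) := by
  have hay := hy.absCont_self
  have haz := hz.absCont_self
  have hady := hy.absCont a Set.left_mem_uIcc b Set.right_mem_uIcc
  have hadz := hz.absCont a Set.left_mem_uIcc b Set.right_mem_uIcc
  refine integral_eq_sub_of_absolutelyContinuousOnInterval
    (f := fun x => y x * dz x - dy x * z x) ?_ ?_ ?_
  · exact (hay.fun_smul hadz).fun_sub (hady.fun_smul haz)
  · refine IntervalIntegrable.mul_continuousOn ?_ (hy.continuousOn.mul hz.continuousOn)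
    exact (hp.complexOfReal.sub hq.complexOfReal).add intervalIntegrable_const
  -- At the end-points only one-sided derivatives are available; these two points form a null set
  -- and are discarded.
  · filter_upwards [hy.eqn, hz.eqn, ae_ne_real a, ae_ne_real b] with x h1 h2 h3 h4 hx
    have hnhds : Set.uIcc a b ∈ 𝓝 x := by
      rw [Set.uIcc, Set.mem_Icc] at hx
      refine Icc_mem_nhds (lt_of_le_of_ne hx.1 ?_) (lt_of_le_of_ne hx.2 ?_)
      · rcases min_choice a b with h | h <;> rw [h] <;> tauto
      · rcases max_choice a b with h | h <;> rw [h] <;> tauto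
    have h5 := (hy.hasDeriv x hx).hasDerivAt hnhds
    have h6 := (hz.hasDeriv x hx).hasDerivAt hnhds
    convert! (h5.mul (h2 hx)).sub ((h1 hx).mul h6) using 1
    ring

/-! ### Weighted Volterra operators -/

/-- The exponent of the weight in which Volterra operators with kernel bounded by `k` are
contractions. -/
noncomputable def weight (k : ℝ → ℝ) (a x : ℝ) : ℝ := 2 * |∫ t in a..x, k t|

section Volterra

variable {k : ℝ → ℝ} (a : ℝ)

theorem continuous_weight (hk : ∀ u v, IntervalIntegrable k volume u v) :
    Continuous (weight k a) :=
  continuous_const.mul (intervalIntegral.continuous_primitive hk a).abs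

theorem weight_nonneg (x : ℝ) : 0 ≤ weight k a x := by unfold weight; positivity

/-- The exponential is Lipschitz on the bounded range of the primitive, so the composition stays
absolutely continuous and the chain rule can be integrated. -/
theorem integral_mul_exp_primitive (hk : ∀ u v, IntervalIntegrable k volume u v) (s x : ℝ) :
    ∫ t in a..x, s * k t * Real.exp (s * ∫ r in a..t, k r) =
      Real.exp (s * ∫ r in a..x, k r) - 1 := by
  have hc : Continuous fun x => ∫ r in a..x, k r := intervalIntegral.continuous_primitive hk a
  have hac : AbsolutelyContinuousOnInterval (fun x => ∫ r in a..x, k r) a x :=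
    absolutelyContinuousOnInterval_integral (hk a x) Set.left_mem_uIcc
  obtain ⟨B, hB⟩ := (isCompact_uIcc (a := a) (b := x)).exists_bound_of_continuousOn
    (continuous_const.mul hc : Continuous fun x => s * ∫ r in a..x, k r).continuousOn
  rw [integral_eq_sub_of_absolutelyContinuousOnInterval
    (f := fun x => Real.exp (s * ∫ r in a..x, k r))]
  · simp
  · refine absolutelyContinuousOnInterval_of_dist_le (Real.exp B * |s|) hac fun u hu v hv => ?_
    have hL : ∀ p ∈ Set.Iic B, ∀ r ∈ Set.Iic B,
        ‖Real.exp p - Real.exp r‖ ≤ Real.exp B * ‖p - r‖ := fun p hp r hr =>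
      (convex_Iic B).norm_image_sub_le_of_norm_hasDerivWithin_le
        (fun w _ => (Real.hasDerivAt_exp w).hasDerivWithinAt)
        (fun w hw => by rw [Real.norm_eq_abs, Real.abs_exp]; exact Real.exp_le_exp.mpr hw) hr hp
    have := hL _ ((le_abs_self _).trans (hB u hu)) _ ((le_abs_self _).trans (hB v hv))
    rw [Real.dist_eq, Real.dist_eq, mul_assoc, ← abs_mul, mul_sub]
    exact this
  · exact ((hk a x).const_mul s).mul_continuousOn
      (Real.continuous_exp.comp (continuous_const.mul hc)).continuousOn
  · filter_upwards [(hk a x).ae_hasDerivAt_integral] with t h ht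
    convert! ((h ht a Set.left_mem_uIcc).const_mul s).exp using 1
    ring

/-- On each side of a the weight φ is ±2 times the primitive of k, so k e^φ integrates to ±(e^φ -
1)/2. The factor 1/2 becomes the contraction constant of `volterra`. -/
theorem abs_integral_mul_exp_weight_le (hk : ∀ u v, IntervalIntegrable k volume u v)
    (hk0 : ∀ x, 0 ≤ k x) (x : ℝ) :
    |∫ t in a..x, k t * Real.exp (weight k a t)| ≤ Real.exp (weight k a x) / 2 := by
  obtain ⟨s, hs, hsx⟩ : ∃ s : ℝ, |s| = 2 ∧
      ∀ t ∈ Set.uIcc a x, weight k a t = s * ∫ r in a..t, k r := by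
    rcases le_total a x with h | h
    · refine ⟨2, by norm_num, fun t ht => ?_⟩
      rw [Set.uIcc_of_le h] at ht
      rw [weight, abs_of_nonneg (intervalIntegral.integral_nonneg ht.1 fun u _ => hk0 u)]
    · refine ⟨-2, by norm_num, fun t ht => ?_⟩
      rw [Set.uIcc_of_ge h] at ht
      rw [weight, intervalIntegral.integral_symm, abs_neg,
        abs_of_nonneg (intervalIntegral.integral_nonneg ht.2 fun u _ => hk0 u)]
      ring
  have h1 := integral_mul_exp_primitive a hk s x
  rw [← hsx x Set.right_mem_uIcc, intervalIntegral.integral_congr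
    (g := fun t => s * (k t * Real.exp (weight k a t)))
    (fun t ht => by simp only [hsx t ht]; ring), intervalIntegral.integral_const_mul] at h1
  have h2 := congrArg abs h1
  rw [abs_mul, hs, abs_of_nonneg
    (sub_nonneg.mpr (Real.one_le_exp (weight_nonneg a x)))] at h2
  linarith

variable {g : ℝ → ℂ}

theorem intervalIntegrable_of_norm_le (hk : ∀ u v, IntervalIntegrable k volume u v)
    (hg : AEStronglyMeasurable g volume) (hgk : ∀ x, ‖g x‖ ≤ k x) (u v : ℝ) :
    IntervalIntegrable g volume u v :=
  (hk u v).mono_fun hg.restrict (Eventually.of_forall fun x =>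
    (hgk x).trans (le_abs_self _))

open BoundedContinuousFunction in
/-- The operator `f ↦ e^{-φ} ∫_a^x g e^{φ} f` on bounded continuous functions, `φ` the weight. -/
noncomputable def volterra (hk : ∀ u v, IntervalIntegrable k volume u v) (hk0 : ∀ x, 0 ≤ k x)
    (hg : AEStronglyMeasurable g volume) (hgk : ∀ x, ‖g x‖ ≤ k x) :
    (ℝ →ᵇ ℂ) →L[ℂ] (ℝ →ᵇ ℂ) :=
  have hI : ∀ (f : ℝ →ᵇ ℂ) u v,
      IntervalIntegrable (fun t => g t * ((Real.exp (weight k a t) : ℂ) * f t)) volume u v :=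
    fun f u v => (intervalIntegrable_of_norm_le hk hg hgk u v).mul_continuousOn
      (by have := continuous_weight a hk; fun_prop)
  have hb : ∀ (f : ℝ →ᵇ ℂ) x, ‖(Real.exp (-weight k a x) : ℂ) *
      ∫ t in a..x, g t * ((Real.exp (weight k a t) : ℂ) * f t)‖ ≤ 1 / 2 * ‖f‖ := fun f x => by
    have h1 : ‖∫ t in a..x, g t * ((Real.exp (weight k a t) : ℂ) * f t)‖ ≤
        |∫ t in a..x, ‖f‖ * (k t * Real.exp (weight k a t))| := by
      refine intervalIntegral.norm_integral_le_abs_of_norm_le (Eventually.of_forall fun t => ?_) ?_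
      · rw [norm_mul, norm_mul, Complex.norm_real, Real.norm_eq_abs, Real.abs_exp]
        have := mul_le_mul (hgk t) (f.norm_coe_le_norm t) (norm_nonneg _) (hk0 t)
        have := mul_le_mul_of_nonneg_right this (Real.exp_nonneg (weight k a t))
        linarith
      · exact ((hk a x).mul_continuousOn
          (by have := continuous_weight a hk; fun_prop)).const_mul _
    rw [intervalIntegral.integral_const_mul, abs_mul, abs_norm] at h1
    have h2 := abs_integral_mul_exp_weight_le a hk hk0 x
    rw [norm_mul, Complex.norm_real, Real.norm_eq_abs, Real.abs_exp]
    calc _ ≤ Real.exp (-weight k a x) * (‖f‖ * (Real.exp (weight k a x) / 2)) := by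
          gcongr; exact h1.trans (by gcongr)
      _ = 1 / 2 * ‖f‖ := by rw [Real.exp_neg]; field_simp
  LinearMap.mkContinuous
    { toFun := fun f => BoundedContinuousFunction.ofNormedAddCommGroup
        (fun x => (Real.exp (-weight k a x) : ℂ) *
          ∫ t in a..x, g t * ((Real.exp (weight k a t) : ℂ) * f t))
        (by
          have h1 := continuous_weight a hk
          have h2 := intervalIntegral.continuous_primitive (hI f) a
          fun_prop) (1 / 2 * ‖f‖) (hb f)
      map_add' := fun f h => by
        ext x
        simp only [BoundedContinuousFunction.coe_ofNormedAddCommGroup,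
          BoundedContinuousFunction.coe_add, Pi.add_apply, mul_add]
        rw [intervalIntegral.integral_add (hI f _ _) (hI h _ _), mul_add]
      map_smul' := fun c f => by
        ext x
        simp only [BoundedContinuousFunction.coe_ofNormedAddCommGroup,
          BoundedContinuousFunction.coe_smul, smul_eq_mul, RingHom.id_apply]
        have h : ∫ t in a..x, g t * ((Real.exp (weight k a t) : ℂ) * (c * f t)) =
            c * ∫ t in a..x, g t * ((Real.exp (weight k a t) : ℂ) * f t) := by
          rw [← intervalIntegral.integral_const_mul]
          exact intervalIntegral.integral_congr fun t _ => by ring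
        rw [h]; ring }
    (1 / 2) (fun f =>
      (BoundedContinuousFunction.norm_le (by positivity)).mpr (hb f))

open BoundedContinuousFunction in
theorem volterra_apply (hk : ∀ u v, IntervalIntegrable k volume u v) (hk0 : ∀ x, 0 ≤ k x)
    (hg : AEStronglyMeasurable g volume) (hgk : ∀ x, ‖g x‖ ≤ k x) (f : ℝ →ᵇ ℂ) (x : ℝ) :
    volterra a hk hk0 hg hgk f x = (Real.exp (-weight k a x) : ℂ) *
      ∫ t in a..x, g t * ((Real.exp (weight k a t) : ℂ) * f t) := rfl

theorem norm_volterra_le (hk : ∀ u v, IntervalIntegrable k volume u v) (hk0 : ∀ x, 0 ≤ k x)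
    (hg : AEStronglyMeasurable g volume) (hgk : ∀ x, ‖g x‖ ≤ k x) :
    ‖volterra a hk hk0 hg hgk‖ ≤ 1 / 2 := by
  unfold volterra
  exact LinearMap.mkContinuous_norm_le _ (by norm_num) _

end Volterra

/-! ### Existence and analytic dependence on the spectral parameter -/

theorem _root_.MeasureTheory.LocallyIntegrable.intervalIntegrable_real {E : Type*}
    [NormedAddCommGroup E] {f : ℝ → E} (hf : LocallyIntegrable f volume) (u v : ℝ) :
    IntervalIntegrable f volume u v :=
  (hf.integrableOn_isCompact isCompact_uIcc).intervalIntegrable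

theorem isSolutionOn_univ_of_integral_eq {q : ℝ → ℝ} (hq : LocallyIntegrable q volume) {lam : ℂ}
    {a : ℝ} {α β : ℂ} {y dy : ℝ → ℂ} (hyc : Continuous y) (hdyc : Continuous dy)
    (hy : ∀ x, y x = α + ∫ t in a..x, dy t)
    (hdy : ∀ x, dy x = β + ∫ t in a..x, ((q t : ℂ) - lam) * y t) :
    IsSolutionOn q lam Set.univ y dy := by
  have hqc : LocallyIntegrable (fun t => ((q t : ℂ) - lam) * y t) volume := by
    have h1 : LocallyIntegrable (fun t => ((q t : ℂ) - lam)) volume :=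
      LocallyIntegrable.sub (fun x => (hq x).imp fun s hs => ⟨hs.1, hs.2.ofReal⟩)
        (locallyIntegrable_const lam)
    rw [← locallyIntegrableOn_univ] at h1 ⊢
    exact h1.mul_continuousOn hyc.continuousOn isOpen_univ.isLocallyClosed
  have hy' : y = fun x => α + ∫ t in a..x, dy t := funext hy
  have hdy' : dy = fun x => β + ∫ t in a..x, ((q t : ℂ) - lam) * y t := funext hdy
  refine ⟨fun x _ => ?_, fun b _ c _ => ?_, ?_⟩
  · refine HasDerivAt.hasDerivWithinAt ?_
    rw [hy']
    exact (hdyc.integral_hasStrictDerivAt a x).hasDerivAt.const_add α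
  · have h1 := absolutelyContinuousOnInterval_integral
      (hqc.intervalIntegrable_real b c) Set.left_mem_uIcc
    refine absolutelyContinuousOnInterval_of_dist_le 1 h1 fun u _ v _ => ?_
    rw [hdy u, hdy v, dist_eq_norm, dist_eq_norm, one_mul, add_sub_add_left_eq_sub,
      intervalIntegral.integral_interval_sub_left (hqc.intervalIntegrable_real _ _)
        (hqc.intervalIntegrable_real _ _),
      intervalIntegral.integral_interval_sub_left (hqc.intervalIntegrable_real _ _)
        (hqc.intervalIntegrable_real _ _)]
  · filter_upwards [LocallyIntegrable.ae_hasDerivAt_integral hqc] with x hx _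
    have := (hx a).const_add β
    rwa [← hdy'] at this

/-- Eliminating the derivative from the first-order system leaves the operator 1 - V(W - lam V). It
is inverted by a Neumann series, and inversion is analytic. -/
theorem exists_differentiableOn_inverse {A : Type*} [NormedRing A] [NormedAlgebra ℂ A]
    [CompleteSpace A] (V W : A) {s : Set ℂ} (h : ∀ lam ∈ s, ‖V * (W - lam • V)‖ < 1) :
    ∃ G : ℂ → A, DifferentiableOn ℂ G s ∧ ∀ lam ∈ s, G lam - V * (W - lam • V) * G lam = 1 := by
  have hu : ∀ lam ∈ s, IsUnit (1 - V * (W - lam • V)) := fun lam hl =>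
    isUnit_one_sub_of_norm_lt_one (h lam hl)
  refine ⟨fun lam => Ring.inverse (1 - V * (W - lam • V)), fun lam hl => ?_, fun lam hl => ?_⟩
  · have h1 : DifferentiableAt ℂ (fun lam : ℂ => 1 - V * (W - lam • V)) lam := by fun_prop
    exact ((differentiableAt_inverse (hu lam hl)).comp lam h1).differentiableWithinAt
  · simpa [sub_mul] using Ring.mul_inverse_cancel _ (hu lam hl)

open BoundedContinuousFunction in
-- The equation is the system y = α + ∫ y', y' = β + ∫ (q - lam) y. Multiplication by e^{-φ}, φ the
-- weight, turns it into u = αe + Vw, w = βe + (Vq - lam V)u for bounded unknowns, where both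
-- operators have norm at most 1/2 while |lam| < r.
theorem exists_isSolutionOn_ball {q : ℝ → ℝ} (hq : LocallyIntegrable q volume) (a : ℝ) (α β : ℂ)
    {r : ℝ} (hr : 0 < r) :
    ∃ y dy : ℂ → ℝ → ℂ,
      (∀ lam ∈ Metric.ball (0 : ℂ) r, IsSolutionOn q lam Set.univ (y lam) (dy lam) ∧
        y lam a = α ∧ dy lam a = β) ∧
      (∀ x, DifferentiableOn ℂ (fun lam => y lam x) (Metric.ball 0 r)) ∧
      (∀ x, DifferentiableOn ℂ (fun lam => dy lam x) (Metric.ball 0 r)) ∧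
      ContinuousOn (fun p : ℂ × ℝ => y p.1 p.2) (Metric.ball 0 r ×ˢ Set.univ) := by
  -- This k dominates 1, q and q - lam for every lam in the ball, so a single weight serves all the
  -- operators.
  set k : ℝ → ℝ := fun x => 1 + |q x| + r with hkdef
  have hk : ∀ u v, IntervalIntegrable k volume u v := fun u v =>
    (intervalIntegrable_const.add (hq.intervalIntegrable_real u v).abs).add
      intervalIntegrable_const
  have hk0 : ∀ x, 0 ≤ k x := fun x => by positivity
  have hqm : AEStronglyMeasurable (fun x => (q x : ℂ)) volume :=
    Complex.continuous_ofReal.comp_aestronglyMeasurable hq.aestronglyMeasurable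
  have h1k : ∀ x, ‖(1 : ℂ)‖ ≤ k x := fun x => by
    rw [norm_one]; simp only [hkdef]; linarith [abs_nonneg (q x)]
  have hqk : ∀ x, ‖(q x : ℂ)‖ ≤ k x := fun x => by
    rw [Complex.norm_real, Real.norm_eq_abs]; simp only [hkdef]; linarith
  have hlk : ∀ lam ∈ Metric.ball (0 : ℂ) r, ∀ x, ‖(q x : ℂ) - lam‖ ≤ k x := fun lam hl x => by
    have h1 := norm_sub_le (q x : ℂ) lam
    rw [mem_ball_zero_iff] at hl
    rw [Complex.norm_real, Real.norm_eq_abs] at h1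
    simp only [hkdef]; linarith
  have hwc := continuous_weight a hk
  set V := volterra a hk hk0 (g := fun _ => 1) aestronglyMeasurable_const h1k with hV
  set Vq := volterra a hk hk0 hqm hqk with hVq
  have hVl : ∀ lam (hl : lam ∈ Metric.ball (0 : ℂ) r), Vq - lam • V =
      volterra a hk hk0 (hqm.sub aestronglyMeasurable_const) (hlk lam hl) := fun lam hl => by
    ext f x
    simp only [hV, hVq, _root_.sub_apply, _root_.smul_apply,
      BoundedContinuousFunction.coe_sub, BoundedContinuousFunction.coe_smul, Pi.sub_apply,
      volterra_apply, smul_eq_mul, sub_mul, one_mul]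
    rw [intervalIntegral.integral_sub, mul_sub, intervalIntegral.integral_const_mul]
    · ring
    · exact (intervalIntegrable_of_norm_le hk hqm hqk a x).mul_continuousOn (by fun_prop)
    · exact intervalIntegrable_const.mul_continuousOn (by fun_prop)
  let e : ℝ →ᵇ ℂ := BoundedContinuousFunction.ofNormedAddCommGroup
    (fun x => (Real.exp (-weight k a x) : ℂ)) (by fun_prop) 1 (fun x => by
      rw [Complex.norm_real, Real.norm_eq_abs, Real.abs_exp, Real.exp_le_one_iff]
      linarith [weight_nonneg (k := k) a x])
  have he : ∀ x, e x = (Real.exp (-weight k a x) : ℂ) := fun _ => rfl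
  obtain ⟨G, hGd, hG⟩ := exists_differentiableOn_inverse V Vq (s := Metric.ball (0 : ℂ) r)
    fun lam hl => by
      have h1 := norm_volterra_le a hk hk0 (g := fun _ => 1) aestronglyMeasurable_const h1k
      have h2 := norm_volterra_le a hk hk0 (hqm.sub aestronglyMeasurable_const) (hlk lam hl)
      rw [← hVl lam hl] at h2
      calc ‖V * (Vq - lam • V)‖ ≤ ‖V‖ * ‖Vq - lam • V‖ := norm_mul_le _ _
        _ ≤ 1 / 2 * (1 / 2) := by gcongr
        _ < 1 := by norm_num
  let u : ℂ → (ℝ →ᵇ ℂ) := fun lam => G lam (α • e + V (β • e))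
  let w : ℂ → (ℝ →ᵇ ℂ) := fun lam => β • e + (Vq - lam • V) (u lam)
  have hu : ∀ lam ∈ Metric.ball (0 : ℂ) r, u lam = α • e + V (w lam) := fun lam hl => by
    have h1 : u lam - V ((Vq - lam • V) (u lam)) = α • e + V (β • e) :=
      DFunLike.congr_fun (hG lam hl) (α • e + V (β • e))
    simp only [w, map_add]
    rw [← add_assoc, ← h1, sub_add_cancel]
  have hud : DifferentiableOn ℂ u (Metric.ball 0 r) := fun lam hl =>
    (hGd lam hl).clm_apply (differentiableWithinAt_const _)
  have hwd : DifferentiableOn ℂ w (Metric.ball 0 r) := fun lam hl => by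
    refine (differentiableWithinAt_const _).add (DifferentiableWithinAt.clm_apply ?_ (hud lam hl))
    exact (differentiableWithinAt_const _).sub (differentiableWithinAt_id.smul_const V)
  have hev : ∀ (f : ℂ → (ℝ →ᵇ ℂ)) (x : ℝ), DifferentiableOn ℂ f (Metric.ball 0 r) →
      DifferentiableOn ℂ (fun lam => (Real.exp (weight k a x) : ℂ) * f lam x)
        (Metric.ball 0 r) := fun f x hf lam hl => by
    have := (BoundedContinuousFunction.evalCLM ℂ x (β := ℂ)).differentiableAt.comp_differentiableWithinAt
      lam (hf lam hl)
    exact this.const_mul _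
  have hee : ∀ x, (Real.exp (weight k a x) : ℂ) * (Real.exp (-weight k a x) : ℂ) = 1 := fun x => by
    rw [← Complex.ofReal_mul, ← Real.exp_add]; simp
  refine ⟨fun lam x => Real.exp (weight k a x) * u lam x,
    fun lam x => Real.exp (weight k a x) * w lam x, fun lam hl => ?_, fun x => hev u x hud,
    fun x => hev w x hwd, ?_⟩
  · have hy : ∀ x, (Real.exp (weight k a x) : ℂ) * u lam x =
        α + ∫ t in a..x, (Real.exp (weight k a t) : ℂ) * w lam t := fun x => by
      rw [hu lam hl]
      simp only [BoundedContinuousFunction.coe_add, BoundedContinuousFunction.coe_smul,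
        Pi.add_apply, smul_eq_mul, he, hV, volterra_apply, one_mul]
      rw [mul_add, mul_left_comm, hee, mul_one, ← mul_assoc, hee, one_mul]
    have hdy : ∀ x, (Real.exp (weight k a x) : ℂ) * w lam x =
        β + ∫ t in a..x, ((q t : ℂ) - lam) * ((Real.exp (weight k a t) : ℂ) * u lam t) :=
      fun x => by
        simp only [w, hVl lam hl]
        simp only [BoundedContinuousFunction.coe_add, BoundedContinuousFunction.coe_smul,
          Pi.add_apply, Pi.sub_apply, smul_eq_mul, he, volterra_apply]
        rw [mul_add, mul_left_comm, hee, mul_one, ← mul_assoc, hee, one_mul]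
    exact ⟨isSolutionOn_univ_of_integral_eq hq (by fun_prop) (by fun_prop) hy hdy,
      (hy a).trans (by simp), (hdy a).trans (by simp)⟩
  · have h1 : Continuous fun p : ℂ × ℝ => (Real.exp (weight k a p.2) : ℂ) := by fun_prop
    refine h1.continuousOn.mul ?_
    have h2 : ContinuousOn (fun p : ℂ × ℝ => u p.1) (Metric.ball 0 r ×ˢ Set.univ) :=
      hud.continuousOn.comp continuousOn_fst fun p hp => hp.1
    exact continuous_eval.comp_continuousOn (h2.prodMk continuousOn_snd)

/-! ### Uniqueness, and global families of solutions -/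

/-- Uniqueness by duality: Wronskians of solutions are constant, and solutions with arbitrary data
at x exist, so the data at c determine those at x. -/
theorem IsSolutionOn.eq_of_eq_at {q : ℝ → ℝ} (hq : LocallyIntegrable q volume) {lam : ℂ}
    {I : Set ℝ} [hI : I.OrdConnected] {y dy z dz : ℝ → ℂ} (hy : IsSolutionOn q lam I y dy)
    (hz : IsSolutionOn q lam Set.univ z dz) {c : ℝ} (hc : c ∈ I) (h : y c = z c)
    (h' : dy c = dz c) {x : ℝ} (hx : x ∈ I) : y x = z x ∧ dy x = dz x := by
  have hl : lam ∈ Metric.ball (0 : ℂ) (‖lam‖ + 1) := by simp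
  have key : ∀ α β : ℂ, y x * β - dy x * α = z x * β - dz x * α := fun α β => by
    obtain ⟨w, dw, hw, -⟩ := exists_isSolutionOn_ball hq x α β (r := ‖lam‖ + 1) (by positivity)
    obtain ⟨hw, hwx, hdwx⟩ := hw lam hl
    have h1 := (hy.mono (hI.uIcc_subset hc hx)).wronskian (hq.intervalIntegrable_real c x)
      (hq.intervalIntegrable_real c x) (hw.mono (Set.subset_univ _))
    have h2 := (hz.mono (Set.subset_univ (Set.uIcc c x))).wronskian
      (hq.intervalIntegrable_real c x) (hq.intervalIntegrable_real c x)
      (hw.mono (Set.subset_univ _))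
    simp only [sub_self, add_zero, zero_mul, intervalIntegral.integral_zero, hwx, hdwx] at h1 h2
    rw [h, h'] at h1
    linear_combination h2 - h1
  constructor
  · simpa using key 0 1
  · simpa using key 1 0

theorem IsSolutionOn.add {q : ℝ → ℝ} {lam : ℂ} {I : Set ℝ} {y dy z dz : ℝ → ℂ}
    (hy : IsSolutionOn q lam I y dy) (hz : IsSolutionOn q lam I z dz) :
    IsSolutionOn q lam I (fun x => y x + z x) (fun x => dy x + dz x) where
  hasDeriv x hx := (hy.hasDeriv x hx).add (hz.hasDeriv x hx)
  absCont a ha b hb := (hy.absCont a ha b hb).fun_add (hz.absCont a ha b hb)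
  eqn := by
    filter_upwards [hy.eqn, hz.eqn] with x h1 h2 hx
    exact ((h1 hx).add (h2 hx)).congr_deriv (by ring)

theorem IsSolutionOn.const_mul {q : ℝ → ℝ} {lam : ℂ} {I : Set ℝ} {y dy : ℝ → ℂ}
    (hy : IsSolutionOn q lam I y dy) (c : ℂ) :
    IsSolutionOn q lam I (fun x => c * y x) (fun x => c * dy x) where
  hasDeriv x hx := (hy.hasDeriv x hx).const_mul c
  absCont a ha b hb := (hy.absCont a ha b hb).const_smul c
  eqn := by
    filter_upwards [hy.eqn] with x h1 hx
    exact ((h1 hx).const_mul c).congr_deriv (by ring)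

open ComplexConjugate in
theorem IsSolutionOn.conj {q : ℝ → ℝ} {lam : ℂ} {I : Set ℝ} {y dy : ℝ → ℂ}
    (hy : IsSolutionOn q lam I y dy) :
    IsSolutionOn q (conj lam) I (fun x => conj (y x)) (fun x => conj (dy x)) where
  hasDeriv x hx := Complex.conjCLE.toContinuousLinearMap.hasFDerivAt.comp_hasDerivWithinAt x
    (hy.hasDeriv x hx)
  absCont a ha b hb := absolutelyContinuousOnInterval_of_dist_le 1 (hy.absCont a ha b hb)
    fun x _ y _ => by rw [one_mul]; exact (Complex.dist_conj_conj _ _).le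
  eqn := by
    filter_upwards [hy.eqn] with x h1 hx
    have := Complex.conjCLE.toContinuousLinearMap.hasFDerivAt.comp_hasDerivAt x (h1 hx)
    exact this.congr_deriv (by simp)

theorem IsSolutionOn.congr_of_isOpen {q : ℝ → ℝ} {lam : ℂ} {I : Set ℝ} [hI : I.OrdConnected]
    (hIo : IsOpen I) {y dy z dz : ℝ → ℂ} (hy : IsSolutionOn q lam I y dy)
    (h : ∀ x ∈ I, z x = y x) (h' : ∀ x ∈ I, dz x = dy x) : IsSolutionOn q lam I z dz where
  hasDeriv x hx := by rw [h' x hx]; exact (hy.hasDeriv x hx).congr h (h x hx)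
  absCont a ha b hb := absolutelyContinuousOnInterval_of_dist_le 1 (hy.absCont a ha b hb)
    fun u hu v hv => by
      rw [h' u (hI.uIcc_subset ha hb hu), h' v (hI.uIcc_subset ha hb hv), one_mul]
  eqn := by
    filter_upwards [hy.eqn] with x h1 hx
    rw [h x hx]
    exact (h1 hx).congr_of_eventuallyEq (by filter_upwards [hIo.mem_nhds hx] with t ht using h' t ht)

/-- Global solutions with prescribed data at `a`; they depend analytically on the spectral
parameter. -/
theorem exists_isSolutionOn_family {q : ℝ → ℝ} (hq : LocallyIntegrable q volume) (a : ℝ)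
    (α β : ℂ) :
    ∃ y dy : ℂ → ℝ → ℂ,
      (∀ lam, IsSolutionOn q lam Set.univ (y lam) (dy lam) ∧ y lam a = α ∧ dy lam a = β) ∧
      (∀ x, Differentiable ℂ fun lam => y lam x) ∧ (∀ x, Differentiable ℂ fun lam => dy lam x) ∧
      Continuous fun p : ℂ × ℝ => y p.1 p.2 := by
  choose Y dY h1 h2 h3 h4 using
    fun r : {r : ℝ // 0 < r} => exists_isSolutionOn_ball hq a α β r.2
  let R : ℂ → {r : ℝ // 0 < r} := fun lam => ⟨‖lam‖ + 1, by positivity⟩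
  have hR : ∀ lam, lam ∈ Metric.ball (0 : ℂ) (R lam) := fun lam => by simp [R]
  -- The constructions on different balls use different weights; uniqueness makes them agree where
  -- both are defined and glues them into an entire family.
  have hag : ∀ lam mu, mu ∈ Metric.ball (0 : ℂ) (R lam) → ∀ x,
      Y (R mu) mu x = Y (R lam) mu x ∧ dY (R mu) mu x = dY (R lam) mu x := fun lam mu hmu x => by
    obtain ⟨a1, a2, a3⟩ := h1 (R mu) mu (hR mu)
    obtain ⟨b1, b2, b3⟩ := h1 (R lam) mu hmu
    exact a1.eq_of_eq_at hq b1 (Set.mem_univ a) (a2.trans b2.symm) (a3.trans b3.symm)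
      (Set.mem_univ x)
  have hn : ∀ lam, Metric.ball (0 : ℂ) (R lam) ∈ 𝓝 lam := fun lam =>
    Metric.isOpen_ball.mem_nhds (hR lam)
  refine ⟨fun lam => Y (R lam) lam, fun lam => dY (R lam) lam, fun lam => h1 _ _ (hR lam),
    fun x lam => ?_, fun x lam => ?_, continuous_iff_continuousAt.mpr fun ⟨lam, x⟩ => ?_⟩
  · refine ((h2 (R lam) x).differentiableAt (hn lam)).congr_of_eventuallyEq ?_
    filter_upwards [hn lam] with mu hmu using (hag lam mu hmu x).1
  · refine ((h3 (R lam) x).differentiableAt (hn lam)).congr_of_eventuallyEq ?_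
    filter_upwards [hn lam] with mu hmu using (hag lam mu hmu x).2
  · have hnn : Metric.ball (0 : ℂ) (R lam) ×ˢ (Set.univ : Set ℝ) ∈ 𝓝 (lam, x) :=
      prod_mem_nhds (hn lam) univ_mem
    refine ((h4 (R lam)).continuousAt hnn).congr_of_eventuallyEq ?_
    filter_upwards [hnn] with p hp using (hag lam p.1 hp.1 p.2).1

/-! ### Pairs of global solutions matched at the origin -/

/-- Global solutions `y`, `z` of `-y'' + q y = lam y` (with no condition at the origin) whose
data at the origin are related by `M`. -/
structure IsMatchedPair (q : ℝ → ℝ) (M : Matrix (Fin 2) (Fin 2) ℝ) (lam : ℂ)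
    (y dy z dz : ℝ → ℂ) : Prop where
  left : IsSolutionOn q lam Set.univ y dy
  right : IsSolutionOn q lam Set.univ z dz
  match_zero : z 0 = (M 0 0 : ℂ) * y 0 + (M 0 1 : ℂ) * dy 0
  match_deriv : dz 0 = (M 1 0 : ℂ) * y 0 + (M 1 1 : ℂ) * dy 0

theorem IsSolutionOn.tendsto {q : ℝ → ℝ} {lam : ℂ} {y dy : ℝ → ℂ}
    (h : IsSolutionOn q lam Set.univ y dy) (x : ℝ) {s : Set ℝ} :
    Tendsto y (𝓝[s] x) (𝓝 (y x)) ∧ Tendsto dy (𝓝[s] x) (𝓝 (dy x)) := by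
  constructor
  · have := h.continuousOn.continuousAt (x := x) univ_mem
    exact this.continuousWithinAt
  · have := (h.mono (Set.subset_univ (Set.uIcc (x - 1) (x + 1)))).continuousOn_deriv
    rw [Set.uIcc_of_le (by linarith)] at this
    exact (this.continuousAt (Icc_mem_nhds (by linarith) (by linarith))).continuousWithinAt

theorem IsSolutionOn.continuous {q : ℝ → ℝ} {lam : ℂ} {y dy : ℝ → ℂ}
    (h : IsSolutionOn q lam Set.univ y dy) : Continuous y :=
  continuousOn_univ.mp h.continuousOn

theorem IsMatchedPair.isTransferSolution {q : ℝ → ℝ} {M : Matrix (Fin 2) (Fin 2) ℝ} {lam : ℂ}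
    {y dy z dz : ℝ → ℂ} (h : IsMatchedPair q M lam y dy z dz) (J : Set ℝ) :
    IsTransferSolution q M lam J (fun x => if x < 0 then y x else z x)
      (fun x => if x < 0 then dy x else dz x) where
  left := ((h.left.mono (Set.subset_univ (Set.Iio 0))).congr_of_isOpen isOpen_Iio
    (fun x hx => if_pos hx) (fun x hx => if_pos hx)).mono Set.inter_subset_right
  right := ((h.right.mono (Set.subset_univ (Set.Ioi 0))).congr_of_isOpen isOpen_Ioi
    (fun x hx => if_neg (not_lt.mpr (Set.mem_Ioi.mp hx).le))
    (fun x hx => if_neg (not_lt.mpr (Set.mem_Ioi.mp hx).le))).mono Set.inter_subset_right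
  transfer := by
    refine ⟨y 0, z 0, dy 0, dz 0, ?_, ?_, ?_, ?_, h.match_zero, h.match_deriv⟩
    · exact (h.left.tendsto 0).1.congr' (by
        filter_upwards [self_mem_nhdsWithin] with x hx using (if_pos hx).symm)
    · exact (h.left.tendsto 0).2.congr' (by
        filter_upwards [self_mem_nhdsWithin] with x hx using (if_pos hx).symm)
    · exact (h.right.tendsto 0).1.congr' (by
        filter_upwards [self_mem_nhdsWithin] with x hx
          using (if_neg (not_lt.mpr (Set.mem_Ioi.mp hx).le)).symm)
    · exact (h.right.tendsto 0).2.congr' (by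
        filter_upwards [self_mem_nhdsWithin] with x hx
          using (if_neg (not_lt.mpr (Set.mem_Ioi.mp hx).le)).symm)

/-- The data at S extend the right-hand piece to a solution v on the whole line. The one-sided
limits in the transfer condition then become values at 0, and v is identified by its data there. -/
theorem IsTransferSolution.eq_matchedPair {q : ℝ → ℝ} (hq : LocallyIntegrable q volume)
    {M : Matrix (Fin 2) (Fin 2) ℝ} {lam : ℂ} {J : Set ℝ} [hJ : J.OrdConnected] {S : ℝ}
    (hS : 0 < S) (hJl : -S ∈ J) (hJr : S ∈ J) {w dw y dy z dz : ℝ → ℂ}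
    (hw : IsTransferSolution q M lam J w dw) (h : IsMatchedPair q M lam y dy z dz)
    (hyw : y (-S) = w (-S)) (hdyw : dy (-S) = dw (-S)) :
    (∀ x ∈ J, x < 0 → w x = y x ∧ dw x = dy x) ∧
      ∀ x ∈ J, 0 < x → w x = z x ∧ dw x = dz x := by
  have hsub : Set.Icc (-S) S ⊆ J := hJ.out hJl hJr
  have hleft : ∀ x ∈ J, x < 0 → w x = y x ∧ dw x = dy x := fun x hx hx0 =>
    hw.left.eq_of_eq_at hq h.left (c := -S) ⟨hJl, by simpa using hS⟩ hyw.symm hdyw.symm ⟨hx, hx0⟩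
  refine ⟨hleft, ?_⟩
  obtain ⟨v, dv, hv, -⟩ := exists_isSolutionOn_family hq S (w S) (dw S)
  obtain ⟨hv, hvS, hdvS⟩ := hv lam
  have hright : ∀ x ∈ J, 0 < x → w x = v lam x ∧ dw x = dv lam x := fun x hx hx0 =>
    hw.right.eq_of_eq_at hq hv (c := S) ⟨hJr, hS⟩ hvS.symm hdvS.symm ⟨hx, hx0⟩
  have hel : ∀ᶠ x in 𝓝[<] (0 : ℝ), w x = y x ∧ dw x = dy x := by
    filter_upwards [Ioo_mem_nhdsLT (neg_lt_zero.mpr hS)] with x hx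
    exact hleft x (hsub ⟨hx.1.le, by linarith [hx.2]⟩) hx.2
  have her : ∀ᶠ x in 𝓝[>] (0 : ℝ), w x = v lam x ∧ dw x = dv lam x := by
    filter_upwards [Ioo_mem_nhdsGT hS] with x hx
    exact hright x (hsub ⟨by linarith [hx.1], hx.2.le⟩) hx.1
  obtain ⟨l, r, l', r', hl, hl', hr, hr', hm, hm'⟩ := hw.transfer
  have e1 : l = y 0 := tendsto_nhds_unique (hl.congr' (hel.mono fun x h => h.1))
    (h.left.tendsto 0).1
  have e2 : l' = dy 0 := tendsto_nhds_unique (hl'.congr' (hel.mono fun x h => h.2))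
    (h.left.tendsto 0).2
  have e3 : r = v lam 0 := tendsto_nhds_unique (hr.congr' (her.mono fun x h => h.1))
    (hv.tendsto 0).1
  have e4 : r' = dv lam 0 := tendsto_nhds_unique (hr'.congr' (her.mono fun x h => h.2))
    (hv.tendsto 0).2
  subst e1 e2 e3 e4
  intro x hx hx0
  obtain ⟨h1, h2⟩ := hright x hx hx0
  obtain ⟨h3, h4⟩ := hv.eq_of_eq_at hq h.right (Set.mem_univ 0) (hm.trans h.match_zero.symm)
    (hm'.trans h.match_deriv.symm) (Set.mem_univ x)
  exact ⟨h1.trans h3, h2.trans h4⟩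

theorem IsMatchedPair.lincomb {q : ℝ → ℝ} {M : Matrix (Fin 2) (Fin 2) ℝ} {lam : ℂ}
    {y dy z dz y' dy' z' dz' : ℝ → ℂ} (h : IsMatchedPair q M lam y dy z dz)
    (h' : IsMatchedPair q M lam y' dy' z' dz') (c c' : ℂ) :
    IsMatchedPair q M lam (fun x => c * y x + c' * y' x) (fun x => c * dy x + c' * dy' x)
      (fun x => c * z x + c' * z' x) (fun x => c * dz x + c' * dz' x) where
  left := (h.left.const_mul c).add (h'.left.const_mul c')
  right := (h.right.const_mul c).add (h'.right.const_mul c')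
  match_zero := by rw [h.match_zero, h'.match_zero]; ring
  match_deriv := by rw [h.match_deriv, h'.match_deriv]; ring

open ComplexConjugate in
theorem IsMatchedPair.conj {q : ℝ → ℝ} {M : Matrix (Fin 2) (Fin 2) ℝ} {lam : ℂ}
    {y dy z dz : ℝ → ℂ} (h : IsMatchedPair q M lam y dy z dz) :
    IsMatchedPair q M (conj lam) (fun x => conj (y x)) (fun x => conj (dy x))
      (fun x => conj (z x)) (fun x => conj (dz x)) where
  left := h.left.conj
  right := h.right.conj
  match_zero := by simp [h.match_zero]
  match_deriv := by simp [h.match_deriv]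

theorem IsMatchedPair.eq_of_eq_at {q : ℝ → ℝ} (hq : LocallyIntegrable q volume)
    {M : Matrix (Fin 2) (Fin 2) ℝ} {lam : ℂ} {a : ℝ}
    {y dy z dz y' dy' z' dz' : ℝ → ℂ} (h : IsMatchedPair q M lam y dy z dz)
    (h' : IsMatchedPair q M lam y' dy' z' dz') (e : y a = y' a) (e' : dy a = dy' a) (x : ℝ) :
    (y x = y' x ∧ dy x = dy' x) ∧ z x = z' x ∧ dz x = dz' x := by
  have hl := fun x => h.left.eq_of_eq_at hq h'.left (Set.mem_univ a) e e' (Set.mem_univ x)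
  refine ⟨hl x, h.right.eq_of_eq_at hq h'.right (Set.mem_univ 0) ?_ ?_ (Set.mem_univ x)⟩
  · rw [h.match_zero, h'.match_zero, (hl 0).1, (hl 0).2]
  · rw [h.match_deriv, h'.match_deriv, (hl 0).1, (hl 0).2]

/-- The transfer matrix multiplies Wronskians by det M = 1, so the Lagrange identities on the two
sides add up without a contribution from the origin. -/
theorem IsMatchedPair.wronskian {q : ℝ → ℝ} (hq : LocallyIntegrable q volume)
    {M : Matrix (Fin 2) (Fin 2) ℝ} (hM : M.det = 1) {lam mu : ℂ}
    {y dy z dz y' dy' z' dz' : ℝ → ℂ} (h : IsMatchedPair q M lam y dy z dz)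
    (h' : IsMatchedPair q M mu y' dy' z' dz') (a b : ℝ) :
    (z b * dz' b - dz b * z' b) - (y a * dy' a - dy a * y' a) =
      (lam - mu) * ((∫ x in a..0, y x * y' x) + ∫ x in (0 : ℝ)..b, z x * z' x) := by
  have h1 := (h.left.mono (Set.subset_univ (Set.uIcc a 0))).wronskian
      (hq.intervalIntegrable_real a 0) (hq.intervalIntegrable_real a 0)
      (h'.left.mono (Set.subset_univ _))
  have h2 := (h.right.mono (Set.subset_univ (Set.uIcc 0 b))).wronskian
      (hq.intervalIntegrable_real 0 b) (hq.intervalIntegrable_real 0 b)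
      (h'.right.mono (Set.subset_univ _))
  simp only [sub_self, zero_add, intervalIntegral.integral_const_mul] at h1 h2
  rw [mul_add, h1, h2, h.match_zero, h.match_deriv, h'.match_zero, h'.match_deriv]
  rw [Matrix.det_fin_two] at hM
  have hM' : (M 0 0 : ℂ) * M 1 1 - M 0 1 * M 1 0 = 1 := by exact_mod_cast hM
  linear_combination (y 0 * dy' 0 - dy 0 * y' 0) * hM'

/-- Matched pairs with prescribed data at `a`; they depend analytically on the spectral
parameter. -/
theorem exists_isMatchedPair_family {q : ℝ → ℝ} (hq : LocallyIntegrable q volume)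
    (M : Matrix (Fin 2) (Fin 2) ℝ) (a : ℝ) (α β : ℂ) :
    ∃ y dy z dz : ℂ → ℝ → ℂ,
      (∀ lam, IsMatchedPair q M lam (y lam) (dy lam) (z lam) (dz lam) ∧
        y lam a = α ∧ dy lam a = β) ∧
      (∀ x, Differentiable ℂ fun lam => z lam x) ∧ (∀ x, Differentiable ℂ fun lam => dz lam x) ∧
      (Continuous fun p : ℂ × ℝ => y p.1 p.2) ∧ Continuous fun p : ℂ × ℝ => z p.1 p.2 := by
  obtain ⟨y, dy, hy, hyd, hdyd, hyc⟩ := exists_isSolutionOn_family hq a α β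
  obtain ⟨c, dc, hc, hcd, hdcd, hcc⟩ := exists_isSolutionOn_family hq 0 1 0
  obtain ⟨s, ds, hs, hsd, hdsd, hsc⟩ := exists_isSolutionOn_family hq 0 0 1
  let p : ℂ → ℂ := fun lam => (M 0 0 : ℂ) * y lam 0 + (M 0 1 : ℂ) * dy lam 0
  let r : ℂ → ℂ := fun lam => (M 1 0 : ℂ) * y lam 0 + (M 1 1 : ℂ) * dy lam 0
  have hp : Differentiable ℂ p := ((hyd 0).const_mul _).add ((hdyd 0).const_mul _)
  have hr : Differentiable ℂ r := ((hyd 0).const_mul _).add ((hdyd 0).const_mul _)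
  refine ⟨y, dy, fun lam x => p lam * c lam x + r lam * s lam x,
    fun lam x => p lam * dc lam x + r lam * ds lam x, fun lam => ⟨⟨(hy lam).1, ?_, ?_, ?_⟩,
      (hy lam).2⟩, fun x => (hp.mul (hcd x)).add (hr.mul (hsd x)),
    fun x => (hp.mul (hdcd x)).add (hr.mul (hdsd x)), hyc, ?_⟩
  · exact ((hc lam).1.const_mul _).add ((hs lam).1.const_mul _)
  · simp [(hc lam).2, (hs lam).2, p]
  · simp [(hc lam).2, (hs lam).2, r]
  · have hp' := hp.continuous
    have hr' := hr.continuous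
    exact ((hp'.comp continuous_fst).mul hcc).add ((hr'.comp continuous_fst).mul hsc)

/-! ### The monodromy matrix and the Jost function -/

/-- The matched pairs `(yc, zc)`, `(ys, zs)` with data `(1, 0)`, `(0, 1)` at `-S`, as analytic
functions of the spectral parameter. -/
structure FundamentalSystem (q : ℝ → ℝ) (M : Matrix (Fin 2) (Fin 2) ℝ) (S : ℝ) where
  yc : ℂ → ℝ → ℂ
  dyc : ℂ → ℝ → ℂ
  zc : ℂ → ℝ → ℂ
  dzc : ℂ → ℝ → ℂ
  ys : ℂ → ℝ → ℂ
  dys : ℂ → ℝ → ℂ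
  zs : ℂ → ℝ → ℂ
  dzs : ℂ → ℝ → ℂ
  pair_c : ∀ lam, IsMatchedPair q M lam (yc lam) (dyc lam) (zc lam) (dzc lam)
  pair_s : ∀ lam, IsMatchedPair q M lam (ys lam) (dys lam) (zs lam) (dzs lam)
  yc_left : ∀ lam, yc lam (-S) = 1
  dyc_left : ∀ lam, dyc lam (-S) = 0
  ys_left : ∀ lam, ys lam (-S) = 0
  dys_left : ∀ lam, dys lam (-S) = 1
  differentiable_zc : Differentiable ℂ fun lam => zc lam S
  differentiable_dzc : Differentiable ℂ fun lam => dzc lam S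
  differentiable_zs : Differentiable ℂ fun lam => zs lam S
  differentiable_dzs : Differentiable ℂ fun lam => dzs lam S
  continuous_yc : Continuous fun p : ℂ × ℝ => yc p.1 p.2
  continuous_zc : Continuous fun p : ℂ × ℝ => zc p.1 p.2
  continuous_ys : Continuous fun p : ℂ × ℝ => ys p.1 p.2
  continuous_zs : Continuous fun p : ℂ × ℝ => zs p.1 p.2

theorem nonempty_fundamentalSystem {q : ℝ → ℝ} (hq : LocallyIntegrable q volume)
    (M : Matrix (Fin 2) (Fin 2) ℝ) (S : ℝ) : Nonempty (FundamentalSystem q M S) := by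
  obtain ⟨y, dy, z, dz, h1, h2, h3, h4, h5⟩ := exists_isMatchedPair_family hq M (-S) 1 0
  obtain ⟨y', dy', z', dz', h1', h2', h3', h4', h5'⟩ := exists_isMatchedPair_family hq M (-S) 0 1
  exact ⟨⟨y, dy, z, dz, y', dy', z', dz', fun l => (h1 l).1, fun l => (h1' l).1,
    fun l => (h1 l).2.1, fun l => (h1 l).2.2, fun l => (h1' l).2.1, fun l => (h1' l).2.2,
    h2 S, h3 S, h2' S, h3' S, h4, h5, h4', h5'⟩⟩

namespace FundamentalSystem

variable {q : ℝ → ℝ} {M : Matrix (Fin 2) (Fin 2) ℝ} {S : ℝ} (F : FundamentalSystem q M S)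

/-- The first component, to the left of the origin, of the matched pair with the data
`(1, -iζ)` of `e^{-iζ(x+S)}` at `-S`. -/
noncomputable def yj (ζ : ℂ) (x : ℝ) : ℂ :=
  1 * F.yc (ζ ^ 2) x + -(Complex.I * ζ) * F.ys (ζ ^ 2) x

/-- The derivative of `yj`. -/
noncomputable def dyj (ζ : ℂ) (x : ℝ) : ℂ :=
  1 * F.dyc (ζ ^ 2) x + -(Complex.I * ζ) * F.dys (ζ ^ 2) x

/-- The continuation of `yj` to the right of the origin. -/
noncomputable def zj (ζ : ℂ) (x : ℝ) : ℂ :=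
  1 * F.zc (ζ ^ 2) x + -(Complex.I * ζ) * F.zs (ζ ^ 2) x

/-- The derivative of `zj`. -/
noncomputable def dzj (ζ : ℂ) (x : ℝ) : ℂ :=
  1 * F.dzc (ζ ^ 2) x + -(Complex.I * ζ) * F.dzs (ζ ^ 2) x

theorem pair_j (ζ : ℂ) : IsMatchedPair q M (ζ ^ 2) (F.yj ζ) (F.dyj ζ) (F.zj ζ) (F.dzj ζ) :=
  (F.pair_c _).lincomb (F.pair_s _) _ _

theorem yj_left (ζ : ℂ) : F.yj ζ (-S) = 1 := by simp [yj, F.yc_left, F.ys_left]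

theorem dyj_left (ζ : ℂ) : F.dyj ζ (-S) = -(Complex.I * ζ) := by
  simp [dyj, F.dyc_left, F.dys_left]

/-- The Wronskian of the solution with data `(1, -iζ)` at `-S` and `e^{iζ(x-S)}`, at `S`. Up to
elementary factors it is the coefficient `A(ζ)`. -/
noncomputable def P (ζ : ℂ) : ℂ := Complex.I * ζ * F.zj ζ S - F.dzj ζ S

/-- The counterpart of `P` for the coefficient `B(ζ)`. -/
noncomputable def Q (ζ : ℂ) : ℂ := Complex.I * ζ * F.zj ζ S + F.dzj ζ S

/-- The integral over `[-S, S]` of the product of the solutions for `ζ` and `ω`. -/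
noncomputable def overlap (ζ ω : ℂ) : ℂ :=
  (∫ x in (-S)..0, F.yj ζ x * F.yj ω x) + ∫ x in (0 : ℝ)..S, F.zj ζ x * F.zj ω x

theorem differentiable_zj : Differentiable ℂ fun ζ => F.zj ζ S := by
  have h1 := F.differentiable_zc
  have h2 := F.differentiable_zs
  have hs : Differentiable ℂ fun ζ : ℂ => ζ ^ 2 := by fun_prop
  exact ((h1.comp hs).const_mul 1).add
    (((differentiable_id.const_mul Complex.I).neg).mul (h2.comp hs))

theorem differentiable_dzj : Differentiable ℂ fun ζ => F.dzj ζ S := by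
  have h1 := F.differentiable_dzc
  have h2 := F.differentiable_dzs
  have hs : Differentiable ℂ fun ζ : ℂ => ζ ^ 2 := by fun_prop
  exact ((h1.comp hs).const_mul 1).add
    (((differentiable_id.const_mul Complex.I).neg).mul (h2.comp hs))

theorem differentiable_P : Differentiable ℂ F.P :=
  ((differentiable_id.const_mul Complex.I).mul F.differentiable_zj).sub F.differentiable_dzj

theorem continuous_yj : Continuous fun p : ℂ × ℝ => F.yj p.1 p.2 := by
  have hs : Continuous fun p : ℂ × ℝ => (p.1 ^ 2, p.2) := by fun_prop
  have h1 := F.continuous_yc.comp hs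
  have h2 := F.continuous_ys.comp hs
  exact (continuous_const.mul h1).add (((continuous_const.mul continuous_fst).neg).mul h2)

theorem continuous_zj : Continuous fun p : ℂ × ℝ => F.zj p.1 p.2 := by
  have hs : Continuous fun p : ℂ × ℝ => (p.1 ^ 2, p.2) := by fun_prop
  have h1 := F.continuous_zc.comp hs
  have h2 := F.continuous_zs.comp hs
  exact (continuous_const.mul h1).add (((continuous_const.mul continuous_fst).neg).mul h2)

theorem continuous_overlap (ζ : ℂ) : Continuous fun ω => F.overlap ζ ω := by
  refine Continuous.add ?_ ?_
  · refine intervalIntegral.continuous_parametric_intervalIntegral_of_continuous' ?_ _ _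
    have h := F.continuous_yj
    exact (h.comp (continuous_const.prodMk continuous_snd)).mul h
  · refine intervalIntegral.continuous_parametric_intervalIntegral_of_continuous' ?_ _ _
    have h := F.continuous_zj
    exact (h.comp (continuous_const.prodMk continuous_snd)).mul h

/-- Putting ω = -conj ζ locates the zeros of `P` and gives unitarity; letting ω tend to ζ shows that
the zeros are simple. -/
theorem wronskian_j (hq : LocallyIntegrable q volume) (hM : M.det = 1) (ζ ω : ℂ) :
    F.zj ζ S * F.dzj ω S - F.dzj ζ S * F.zj ω S =
      Complex.I * (ζ - ω) + (ζ ^ 2 - ω ^ 2) * F.overlap ζ ω := by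
  have h := (F.pair_j ζ).wronskian hq hM (F.pair_j ω) (-S) S
  rw [F.yj_left, F.yj_left, F.dyj_left, F.dyj_left] at h
  rw [overlap, ← h]; ring

theorem det_eq_one (hq : LocallyIntegrable q volume) (hM : M.det = 1) (lam : ℂ) :
    F.zc lam S * F.dzs lam S - F.dzc lam S * F.zs lam S = 1 := by
  have h := (F.pair_c lam).wronskian hq hM (F.pair_s lam) (-S) S
  rw [F.yc_left, F.dyc_left, F.ys_left, F.dys_left, sub_self, zero_mul] at h
  linear_combination h

open ComplexConjugate

/-- The coefficients are real, and conjugation carries the data (1, -iζ) to those belonging to -conj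
ζ. -/
theorem conj_j (hq : LocallyIntegrable q volume) (ζ : ℂ) (x : ℝ) :
    F.yj (-conj ζ) x = conj (F.yj ζ x) ∧ F.zj (-conj ζ) x = conj (F.zj ζ x) ∧
      F.dzj (-conj ζ) x = conj (F.dzj ζ x) := by
  have h1 := (F.pair_j ζ).conj
  have h2 := F.pair_j (-conj ζ)
  rw [neg_sq, ← map_pow] at h2
  have h := h2.eq_of_eq_at hq h1 (a := -S) (by simp [F.yj_left]) (by simp [F.dyj_left]) x
  exact ⟨h.1.1, h.2⟩

theorem overlap_conj (hq : LocallyIntegrable q volume) (hS : 0 ≤ S) (ζ : ℂ) :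
    ∃ r : ℝ, 0 ≤ r ∧ F.overlap ζ (-conj ζ) = r := by
  refine ⟨(∫ x in (-S)..0, ‖F.yj ζ x‖ ^ 2) + ∫ x in (0 : ℝ)..S, ‖F.zj ζ x‖ ^ 2,
    add_nonneg (intervalIntegral.integral_nonneg (by linarith) fun x _ => by positivity)
      (intervalIntegral.integral_nonneg hS fun x _ => by positivity), ?_⟩
  push_cast
  rw [← intervalIntegral.integral_ofReal, ← intervalIntegral.integral_ofReal, overlap]
  congr 1
  · refine intervalIntegral.integral_congr fun x _ => ?_
    simp only [(F.conj_j hq ζ x).1, Complex.mul_conj']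
    push_cast; rfl
  · refine intervalIntegral.integral_congr fun x _ => ?_
    simp only [(F.conj_j hq ζ x).2.1, Complex.mul_conj']
    push_cast; rfl

/-- The zeros of `P` in the closed upper half-plane lie on the imaginary axis. -/
theorem re_eq_zero_of_P_eq_zero (hq : LocallyIntegrable q volume) (hM : M.det = 1) (hS : 0 ≤ S)
    {ζ : ℂ} (hζ : 0 ≤ ζ.im) (hP : F.P ζ = 0) : ζ.re = 0 := by
  obtain ⟨r, hr, hr'⟩ := F.overlap_conj hq hS ζ
  have h := F.wronskian_j hq hM ζ (-conj ζ)
  have hv : F.dzj ζ S = Complex.I * ζ * F.zj ζ S := (sub_eq_zero.mp hP).symm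
  rw [hr', (F.conj_j hq ζ S).2.1, (F.conj_j hq ζ S).2.2, hv] at h
  set u := F.zj ζ S
  have h2 := congrArg Complex.im h
  simp only [map_mul, Complex.conj_I, pow_two, Complex.sub_im, Complex.add_im, Complex.mul_im,
    Complex.mul_re, Complex.conj_re, Complex.conj_im, Complex.I_re, Complex.I_im, Complex.neg_re,
    Complex.neg_im, Complex.sub_re, Complex.ofReal_re, Complex.ofReal_im] at h2
  -- For Im ζ > 0 the second factor is 2 Im ζ times the squared L² norm on the line: 1 and |u|² are
  -- contributed by the two exponential tails. It stays positive when Im ζ = 0.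
  have h3 : ζ.re * (u.re ^ 2 + u.im ^ 2 + 1 + 2 * ζ.im * r) = 0 := by
    linear_combination (-1 / 2) * h2
  rcases mul_eq_zero.mp h3 with h4 | h4
  · exact h4
  · have : 0 < u.re ^ 2 + u.im ^ 2 + 1 + 2 * ζ.im * r := by positivity
    exact absurd h4 this.ne'

theorem P_ofReal_ne_zero (hq : LocallyIntegrable q volume) (hM : M.det = 1) (hS : 0 ≤ S)
    {ξ : ℝ} (hξ : ξ ≠ 0) : F.P ξ ≠ 0 := fun h =>
  hξ (by simpa using F.re_eq_zero_of_P_eq_zero hq hM hS (ζ := ξ) (by simp) h)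

/-- The zeros of `P` in the closed upper half-plane are simple. -/
theorem deriv_P_ne_zero (hq : LocallyIntegrable q volume) (hM : M.det = 1) (hS : 0 ≤ S)
    {ζ : ℂ} (hζ : 0 ≤ ζ.im) (hP : F.P ζ = 0) : deriv F.P ζ ≠ 0 := by
  have hre := F.re_eq_zero_of_P_eq_zero hq hM hS hζ hP
  have hconj : -conj ζ = ζ := by apply Complex.ext <;> simp [hre]
  obtain ⟨r, hr, hr'⟩ := F.overlap_conj hq hS ζ
  have hu : conj (F.zj ζ S) = F.zj ζ S := by rw [← (F.conj_j hq ζ S).2.1, hconj]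
  rw [hconj] at hr'
  have hv : F.dzj ζ S = Complex.I * ζ * F.zj ζ S := (sub_eq_zero.mp hP).symm
  -- When P(ζ) = 0, `wronskian_j` becomes divisible by ω - ζ, with quotient g. Hence g(ζ) is the
  -- value of `zj` at S times P'(ζ), and it is i times a positive number because ζ lies on the
  -- imaginary axis.
  let g : ℂ → ℂ := fun ω =>
    Complex.I * F.zj ζ S * F.zj ω S + Complex.I + (ζ + ω) * F.overlap ζ ω
  have hg : Continuous g := by
    have h1 := F.differentiable_zj.continuous
    have h2 := F.continuous_overlap ζ
    fun_prop
  have hPg : ∀ ω, F.zj ζ S * F.P ω = (ω - ζ) * g ω := fun ω => by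
    have h := F.wronskian_j hq hM ζ ω
    rw [hv] at h
    simp only [P, g]
    linear_combination -h
  have hd1 : HasDerivAt (fun ω => F.zj ζ S * F.P ω) (F.zj ζ S * deriv F.P ζ) ζ :=
    (F.differentiable_P ζ).hasDerivAt.const_mul _
  have hd2 : HasDerivAt (fun ω => F.zj ζ S * F.P ω) (g ζ) ζ := by
    rw [hasDerivAt_iff_tendsto_slope]
    refine (hg.continuousAt.tendsto.mono_left nhdsWithin_le_nhds).congr' ?_
    filter_upwards [self_mem_nhdsWithin] with ω hω
    have hω' : ω - ζ ≠ 0 := sub_ne_zero.mpr hω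
    rw [slope_def_field, hPg, hPg, sub_self, zero_mul, sub_zero, mul_div_cancel_left₀ _ hω']
  have heq := hd1.unique hd2
  intro h0
  rw [h0, mul_zero] at heq
  have him : (F.zj ζ S).im = 0 := Complex.conj_eq_iff_im.mp hu
  have h2 := congrArg Complex.im heq
  simp only [g, hr', Complex.zero_im, Complex.add_im, Complex.mul_im, Complex.mul_re,
    Complex.I_re, Complex.I_im, Complex.add_re, Complex.ofReal_re, Complex.ofReal_im, him] at h2
  have : 0 < (F.zj ζ S).re ^ 2 + 1 + 2 * ζ.im * r := by positivity
  apply this.ne'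
  linear_combination -h2

/-- Unitarity of the scattering data. -/
theorem norm_P_sq_sub_norm_Q_sq (hq : LocallyIntegrable q volume) (hM : M.det = 1) (ξ : ℝ) :
    ‖F.P ξ‖ ^ 2 - ‖F.Q ξ‖ ^ 2 = 4 * ξ ^ 2 := by
  have h := F.wronskian_j hq hM ξ (-conj (ξ : ℂ))
  rw [(F.conj_j hq ξ S).2.1, (F.conj_j hq ξ S).2.2] at h
  -- The parameters ξ and -ξ have the same square, so the overlap drops out and the Wronskian with
  -- the conjugate is explicit.
  rw [Complex.conj_ofReal, neg_sq, sub_self, zero_mul, add_zero] at h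
  have h2 := congrArg Complex.im h
  simp only [Complex.sub_im, Complex.mul_im, Complex.conj_re, Complex.conj_im, Complex.I_re,
    Complex.I_im, Complex.neg_im, Complex.neg_re, Complex.sub_re, Complex.ofReal_re,
    Complex.ofReal_im] at h2
  rw [P, Q, ← Complex.normSq_eq_norm_sq, ← Complex.normSq_eq_norm_sq]
  simp only [Complex.normSq_apply, Complex.sub_im, Complex.sub_re, Complex.add_im, Complex.add_re,
    Complex.mul_im, Complex.mul_re, Complex.I_re, Complex.I_im, Complex.ofReal_re,
    Complex.ofReal_im]
  linear_combination 2 * ξ * h2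

end FundamentalSystem

/-! ### Solutions where the potential vanishes -/

theorem IsSolutionOn.congr_potential {q p : ℝ → ℝ} {lam : ℂ} {I : Set ℝ} {y dy : ℝ → ℂ}
    (h : IsSolutionOn q lam I y dy) (hqp : ∀ᵐ x : ℝ, x ∈ I → q x = p x) :
    IsSolutionOn p lam I y dy where
  hasDeriv := h.hasDeriv
  absCont := h.absCont
  eqn := by filter_upwards [h.eqn, hqp] with x h1 h2 hx; rw [← h2 hx]; exact h1 hx

theorem hasDerivAt_cexp_mul_sub (w : ℂ) (c x : ℝ) :
    HasDerivAt (fun x : ℝ => Complex.exp (w * (x - c))) (w * Complex.exp (w * (x - c))) x := by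
  have h1 : HasDerivAt (fun x : ℝ => w * ((x : ℂ) - c)) (w * 1) x :=
    ((Complex.ofRealCLM.hasDerivAt (x := x)).sub_const (c : ℂ)).const_mul w
  have := h1.cexp
  rw [mul_one] at this
  rwa [mul_comm w (Complex.exp _)]

theorem isSolutionOn_exp (ζ : ℂ) (c : ℝ) :
    IsSolutionOn (fun _ => 0) (ζ ^ 2) Set.univ (fun x => Complex.exp (Complex.I * ζ * (x - c)))
      (fun x => Complex.I * ζ * Complex.exp (Complex.I * ζ * (x - c))) where
  hasDeriv x _ := (hasDerivAt_cexp_mul_sub _ c x).hasDerivWithinAt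
  absCont a _ b _ := by
    refine ContDiffOn.absolutelyContinuousOnInterval (ContDiff.contDiffOn ?_)
    exact contDiff_const.mul
      (contDiff_const.mul (Complex.ofRealCLM.contDiff.sub contDiff_const)).cexp
  eqn := Eventually.of_forall fun x _ => by
    refine ((hasDerivAt_cexp_mul_sub _ c x).const_mul _).congr_deriv ?_
    push_cast
    linear_combination ζ ^ 2 * Complex.exp (Complex.I * ζ * (x - c)) * Complex.I_sq

/-- The data at c are prescribed as A + B and iζ(A - B) to avoid a division by ζ, so that ζ = 0 is
allowed. -/
theorem IsSolutionOn.eq_exp {q : ℝ → ℝ} {ζ : ℂ} {I : Set ℝ} [hI : I.OrdConnected]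
    {y dy : ℝ → ℂ} (h : IsSolutionOn q (ζ ^ 2) I y dy) (hq : ∀ᵐ x : ℝ, x ∈ I → q x = 0) {c : ℝ}
    (hc : c ∈ I) {A B : ℂ} (hy : y c = A + B) (hdy : dy c = Complex.I * ζ * (A - B)) {x : ℝ}
    (hx : x ∈ I) :
    y x = A * Complex.exp (Complex.I * ζ * (x - c)) +
      B * Complex.exp (-(Complex.I * ζ * (x - c))) := by
  have h1 := isSolutionOn_exp ζ c
  have h2 := isSolutionOn_exp (-ζ) c
  rw [neg_sq] at h2
  have h3 := (h.congr_potential hq).eq_of_eq_at (locallyIntegrable_const 0)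
    ((h1.const_mul A).add (h2.const_mul B)) hc (by simpa using hy)
    (by rw [hdy]; simp; ring) hx
  rw [h3.1]
  simp

theorem exists_exp_coeff {ζ : ℂ} (hζ : ζ ≠ 0) (α β : ℂ) :
    (α + β / (Complex.I * ζ)) / 2 + (α - β / (Complex.I * ζ)) / 2 = α ∧
      Complex.I * ζ * ((α + β / (Complex.I * ζ)) / 2 - (α - β / (Complex.I * ζ)) / 2) = β := by
  have := Complex.I_ne_zero
  constructor
  · ring
  · field_simp; ring

theorem ae_eq_zero_of_notMem_Icc {q : ℝ → ℝ} {S : ℝ}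
    (hq0 : ∀ᵐ x : ℝ, x ∉ Set.Icc (-S) S → q x = 0) :
    (∀ᵐ x : ℝ, x ∈ Set.Iic (-S) → q x = 0) ∧ ∀ᵐ x : ℝ, x ∈ Set.Ici S → q x = 0 := by
  constructor
  · filter_upwards [hq0, ae_ne_real (-S)] with x h1 h2 hx
    exact h1 fun h => h2 (le_antisymm hx h.1)
  · filter_upwards [hq0, ae_ne_real S] with x h1 h2 hx
    exact h1 fun h => h2 (le_antisymm h.2 hx)

theorem norm_exp_I_mul (ζ : ℂ) (t : ℝ) :
    ‖Complex.exp (Complex.I * ζ * t)‖ = Real.exp (-(ζ.im * t)) := by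
  rw [Complex.norm_exp]; simp

/-! ### Eigenvalues on the line -/

theorem memLp_exp_Ici {ζ : ℂ} (hζ : 0 < ζ.im) (c : ℝ) :
    MemLp (fun x : ℝ => Complex.exp (Complex.I * ζ * (x - c))) 2 (volume.restrict (Set.Ici c)) := by
  rw [memLp_two_iff_integrable_sq_norm (by
    refine Continuous.aestronglyMeasurable ?_; fun_prop)]
  have h := (integrableOn_exp_mul_Ioi (a := -(2 * ζ.im)) (by linarith) c).const_mul
    (Real.exp (2 * ζ.im * c))
  rw [← IntegrableOn, integrableOn_Ici_iff_integrableOn_Ioi]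
  refine h.congr (Eventually.of_forall fun x => ?_)
  have := norm_exp_I_mul ζ (x - c)
  push_cast at this
  simp only [this, ← Real.exp_add, ← Real.exp_nat_mul]
  congr 1; push_cast; ring

theorem memLp_exp_Iic {ζ : ℂ} (hζ : 0 < ζ.im) (c : ℝ) :
    MemLp (fun x : ℝ => Complex.exp (-(Complex.I * ζ * (x - c)))) 2
      (volume.restrict (Set.Iic c)) := by
  rw [memLp_two_iff_integrable_sq_norm (by
    refine Continuous.aestronglyMeasurable ?_; fun_prop)]
  have h := (integrableOn_exp_mul_Iic (a := 2 * ζ.im) (by linarith) c).const_mul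
    (Real.exp (-(2 * ζ.im * c)))
  refine h.congr (Eventually.of_forall fun x => ?_)
  have := norm_exp_I_mul ζ (-(x - c))
  push_cast at this
  rw [mul_neg] at this
  simp only [this, ← Real.exp_add, ← Real.exp_nat_mul]
  congr 1; push_cast; ring

/-- Otherwise f - A g would be square integrable and yet bounded away from zero on a set of infinite
measure. This excludes the growing exponential on a half-line. -/
theorem eq_zero_of_memLp {s : Set ℝ} (hs : volume s = ⊤) (hsm : MeasurableSet s) {f g h : ℝ → ℂ}
    {A B : ℂ} (hf : MemLp f 2 volume) (hg : MemLp g 2 (volume.restrict s))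
    (hfgh : ∀ x ∈ s, f x = A * g x + B * h x) (hh : ∀ x ∈ s, 1 ≤ ‖h x‖) : B = 0 := by
  have h1 : MemLp (fun x => f x - A * g x) 2 (volume.restrict s) :=
    (hf.restrict s).sub (hg.const_mul A)
  have h2 : MemLp (fun _ : ℝ => B) 2 (volume.restrict s) := by
    refine h1.mono aestronglyMeasurable_const ((ae_restrict_iff' hsm).mpr
      (Eventually.of_forall fun x hx => ?_))
    rw [hfgh x hx, add_sub_cancel_left, norm_mul]
    exact le_mul_of_one_le_right (norm_nonneg _) (hh x hx)
  rw [memLp_const_iff (by norm_num) (by norm_num)] at h2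
  simpa [hs] using h2

namespace FundamentalSystem

variable {q : ℝ → ℝ} {M : Matrix (Fin 2) (Fin 2) ℝ} {S : ℝ} (F : FundamentalSystem q M S)

theorem yj_eq_exp (hq0 : ∀ᵐ x : ℝ, x ∉ Set.Icc (-S) S → q x = 0) (ζ : ℂ) {x : ℝ}
    (hx : x ≤ -S) : F.yj ζ x = Complex.exp (-(Complex.I * ζ * (x - (-S : ℝ)))) := by
  have h := ((F.pair_j ζ).left.mono (Set.subset_univ (Set.Iic (-S)))).eq_exp
    (ae_eq_zero_of_notMem_Icc hq0).1 (c := -S) Set.self_mem_Iic (A := 0) (B := 1)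
    (by rw [F.yj_left]; ring) (by rw [F.dyj_left]; ring) hx
  rw [h]; simp

theorem zj_eq_exp (hq0 : ∀ᵐ x : ℝ, x ∉ Set.Icc (-S) S → q x = 0) {ζ : ℂ} (hζ : ζ ≠ 0) {x : ℝ}
    (hx : S ≤ x) : F.zj ζ x =
      F.Q ζ / (2 * (Complex.I * ζ)) * Complex.exp (Complex.I * ζ * (x - S)) +
      F.P ζ / (2 * (Complex.I * ζ)) * Complex.exp (-(Complex.I * ζ * (x - S))) := by
  have hI := Complex.I_ne_zero
  refine ((F.pair_j ζ).right.mono (Set.subset_univ (Set.Ici S))).eq_exp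
    (ae_eq_zero_of_notMem_Icc hq0).2 (c := S) Set.self_mem_Ici ?_ ?_ hx
  · rw [P, Q]; field_simp; ring
  · rw [P, Q]; field_simp; ring

theorem sq_mem_lineEigenvalues_iff (hq : LocallyIntegrable q volume) (hS : 0 < S)
    (hq0 : ∀ᵐ x : ℝ, x ∉ Set.Icc (-S) S → q x = 0) {ζ : ℂ} (hζ : 0 < ζ.im) :
    ζ ^ 2 ∈ lineEigenvalues q M ↔ F.P ζ = 0 := by
  have hζ0 : ζ ≠ 0 := by rintro rfl; simp at hζ
  have hI := Complex.I_ne_zero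
  constructor
  · rintro ⟨w, dw, hw, hL, x₀, hx₀, hwx₀⟩
    obtain ⟨hA, hB⟩ := exists_exp_coeff hζ0 (w (-S)) (dw (-S))
    set A := (w (-S) + dw (-S) / (Complex.I * ζ)) / 2
    set B := (w (-S) - dw (-S) / (Complex.I * ζ)) / 2
    -- Here A is the coefficient of the exponential growing at -∞. Once it vanishes, w is a multiple
    -- of the solution `yj`, `zj`.
    have hA0 : A = 0 := by
      refine eq_zero_of_memLp (s := Set.Iic (-S)) (by simp) measurableSet_Iic hL
        (memLp_exp_Iic hζ (-S)) (A := B)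
        (h := fun x : ℝ => Complex.exp (Complex.I * ζ * (x - (-S : ℝ)))) (fun x hx => ?_)
        fun x hx => ?_
      · have hsub : Set.Iic (-S) ⊆ Set.univ ∩ Set.Iio 0 := fun t ht =>
          ⟨trivial, lt_of_le_of_lt (Set.mem_Iic.mp ht) (neg_lt_zero.mpr hS)⟩
        rw [(hw.left.mono hsub).eq_exp (ae_eq_zero_of_notMem_Icc hq0).1 Set.self_mem_Iic hA.symm
          hB.symm hx]
        ring
      · have := norm_exp_I_mul ζ (x - (-S : ℝ))
        push_cast at this ⊢
        rw [this]
        refine Real.one_le_exp ?_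
        have hx' : x + S ≤ 0 := by linarith [Set.mem_Iic.mp hx]
        nlinarith
    rw [hA0] at hA hB
    have hm := (F.pair_j ζ).lincomb (F.pair_j ζ) B 0
    simp only [zero_mul, add_zero] at hm
    obtain ⟨hl, hr⟩ := hw.eq_matchedPair hq hS (Set.mem_univ _) (Set.mem_univ _) hm
      (by rw [F.yj_left, ← hA]; ring) (by rw [F.dyj_left, ← hB]; ring)
    have hB0 : B ≠ 0 := fun h0 => hwx₀ (by
      rcases lt_or_gt_of_ne hx₀ with h | h
      · rw [(hl x₀ trivial h).1, h0, zero_mul]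
      · rw [(hr x₀ trivial h).1, h0, zero_mul])
    -- To the right of S the exponential growing at +∞ has a coefficient proportional to `P`.
    have hP : B * (F.P ζ / (2 * (Complex.I * ζ))) = 0 := by
      refine eq_zero_of_memLp (s := Set.Ici S) (by simp) measurableSet_Ici hL
        (memLp_exp_Ici hζ S) (A := B * (F.Q ζ / (2 * (Complex.I * ζ))))
        (h := fun x : ℝ => Complex.exp (-(Complex.I * ζ * (x - S)))) (fun x hx => ?_)
        fun x hx => ?_
      · rw [(hr x trivial (lt_of_lt_of_le hS hx)).1, F.zj_eq_exp hq0 hζ0 hx]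
        ring
      · have := norm_exp_I_mul ζ (-(x - S))
        push_cast at this
        rw [mul_neg] at this
        rw [this]
        refine Real.one_le_exp ?_
        have hx' : 0 ≤ x - S := by linarith [Set.mem_Ici.mp hx]
        nlinarith
    simpa [hB0, hζ0] using hP
  · intro hP
    have hw := (F.pair_j ζ).isTransferSolution Set.univ
    refine ⟨_, _, hw, ?_, -S, by linarith, ?_⟩
    · have hcy := (F.pair_j ζ).left.continuous
      have hcz := (F.pair_j ζ).right.continuous
      have hcover : (Set.univ : Set ℝ) = Set.Iic (-S) ∪ Set.Icc (-S) 0 ∪ Set.Icc 0 S ∪ Set.Ici S := by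
        ext x
        simp only [Set.mem_univ, Set.mem_union, Set.mem_Iic, Set.mem_Icc, Set.mem_Ici, true_iff]
        grind
      have hmeas : Measurable (fun x => if x < 0 then F.yj ζ x else F.zj ζ x) :=
        Measurable.ite measurableSet_Iio hcy.measurable hcz.measurable
      rw [memLp_two_iff_integrable_sq_norm hmeas.aestronglyMeasurable, ← integrableOn_univ, hcover]
      refine IntegrableOn.union (IntegrableOn.union (IntegrableOn.union ?_ ?_) ?_) ?_
      · have := memLp_exp_Iic hζ (-S)
        rw [memLp_two_iff_integrable_sq_norm this.1] at this
        refine IntegrableOn.congr_fun this (fun x hx => ?_) measurableSet_Iic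
        have hx' : x ≤ -S := hx
        rw [if_pos (by linarith : x < 0), F.yj_eq_exp hq0 ζ hx']
      · refine IntegrableOn.congr_fun_ae
          (ContinuousOn.integrableOn_Icc (f := fun x => ‖F.yj ζ x‖ ^ 2) (by fun_prop)) ?_
        refine (ae_restrict_iff' measurableSet_Icc).mpr ?_
        filter_upwards [ae_ne_real 0] with x hx hxI
        rw [if_pos (lt_of_le_of_ne hxI.2 hx)]
      · refine IntegrableOn.congr_fun
          (ContinuousOn.integrableOn_Icc (f := fun x => ‖F.zj ζ x‖ ^ 2) (by fun_prop))
          (fun x hx => ?_) measurableSet_Icc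
        rw [if_neg (not_lt.mpr hx.1)]
      · have := (memLp_exp_Ici hζ S).const_mul (F.Q ζ / (2 * (Complex.I * ζ)))
        rw [memLp_two_iff_integrable_sq_norm this.1] at this
        refine IntegrableOn.congr_fun this (fun x hx => ?_) measurableSet_Ici
        have hx' : S ≤ x := hx
        rw [if_neg (by linarith : ¬ x < 0), F.zj_eq_exp hq0 hζ0 hx', hP]
        simp
    · rw [if_pos (by linarith), F.yj_left]
      exact one_ne_zero

/-! ### The reflection coefficient -/

theorem isMatchedPair_right {y dy z dz : ℝ → ℂ} (hq : LocallyIntegrable q volume) {lam : ℂ}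
    (h : IsMatchedPair q M lam y dy z dz) :
    z S = y (-S) * F.zc lam S + dy (-S) * F.zs lam S ∧
      dz S = y (-S) * F.dzc lam S + dy (-S) * F.dzs lam S :=
  (h.eq_of_eq_at hq ((F.pair_c lam).lincomb (F.pair_s lam) (y (-S)) (dy (-S))) (a := -S)
    (by simp [F.yc_left, F.ys_left]) (by simp [F.dyc_left, F.dys_left]) S).2

/-- The data to take at -S are given by the inverse of the monodromy matrix, which is its adjugate
because the determinant is one. -/
theorem exists_isMatchedPair_right (F : FundamentalSystem q M S)
    (hq : LocallyIntegrable q volume) (hM : M.det = 1)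
    (lam α β : ℂ) : ∃ y dy z dz : ℝ → ℂ, IsMatchedPair q M lam y dy z dz ∧ z S = α ∧ dz S = β := by
  have h := (F.pair_c lam).lincomb (F.pair_s lam) (F.dzs lam S * α - F.zs lam S * β)
    (F.zc lam S * β - F.dzc lam S * α)
  have hd := F.det_eq_one hq hM lam
  exact ⟨_, _, _, _, h, by linear_combination α * hd, by linear_combination β * hd⟩

theorem eq_of_eq_right (F : FundamentalSystem q M S) (hq : LocallyIntegrable q volume)
    (hM : M.det = 1) {lam : ℂ} {y dy z dz y' dy' z' dz' : ℝ → ℂ}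
    (h : IsMatchedPair q M lam y dy z dz) (h' : IsMatchedPair q M lam y' dy' z' dz')
    (e : z S = z' S) (e' : dz S = dz' S) (x : ℝ) : y x = y' x ∧ z x = z' x := by
  have hd := F.det_eq_one hq hM lam
  obtain ⟨h1, h2⟩ := F.isMatchedPair_right hq h
  obtain ⟨h3, h4⟩ := F.isMatchedPair_right hq h'
  rw [h1, h3] at e
  rw [h2, h4] at e'
  have := h.eq_of_eq_at hq h' (a := -S)
    (by linear_combination (y' (-S) - y (-S)) * hd + F.dzs lam S * e - F.zs lam S * e')
    (by linear_combination (dy' (-S) - dy (-S)) * hd + F.zc lam S * e' - F.dzc lam S * e) x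
  exact ⟨this.1.1, this.2.1⟩

end FundamentalSystem

/-- A shift of x by π/(2ξ) reverses the sign of e^{2iξx}, so the limit of the oscillating term
equals its own negative and vanishes, while its modulus is constantly |A|. Translation invariance of
the filter covers both ends of the line. -/
theorem eq_zero_of_tendsto_exp {ξ : ℝ} (hξ : ξ ≠ 0) {l : Filter ℝ} [l.NeBot]
    (hl : ∀ c : ℝ, Tendsto (fun x => x + c) l l) {A B L : ℂ}
    (h : Tendsto (fun x : ℝ => A * Complex.exp (2 * (Complex.I * ξ * x)) + B) l (𝓝 L)) :
    A = 0 ∧ B = L := by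
  have hξ' : (ξ : ℂ) ≠ 0 := by exact_mod_cast hξ
  have h1 : Tendsto (fun x : ℝ => A * Complex.exp (2 * (Complex.I * ξ * x))) l (𝓝 (L - B)) := by
    simpa using h.sub_const B
  have h2 : Tendsto (fun x : ℝ => A * Complex.exp (2 * (Complex.I * ξ * x))) l
      (𝓝 (-(L - B))) := by
    refine ((h1.comp (hl (Real.pi / (2 * ξ)))).neg).congr fun x => ?_
    have : 2 * (Complex.I * ξ * ((x + Real.pi / (2 * ξ) : ℝ) : ℂ)) =
        2 * (Complex.I * ξ * x) + Real.pi * Complex.I := by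
      push_cast; field_simp
    simp only [Function.comp_apply, this, Complex.exp_add, Complex.exp_pi_mul_I]
    ring
  have h3 : L - B = 0 := by
    have := tendsto_nhds_unique h1 h2
    linear_combination this / 2
  rw [h3] at h1
  have h4 : Tendsto (fun _ : ℝ => ‖A‖) l (𝓝 0) := by
    refine (tendsto_zero_iff_norm_tendsto_zero.mp h1).congr fun x => ?_
    have := norm_exp_I_mul (2 * ξ : ℝ) x
    rw [norm_mul, show 2 * (Complex.I * ξ * x) = Complex.I * ((2 * ξ : ℝ) : ℂ) * x by
      push_cast; ring, this]
    simp
  exact ⟨norm_eq_zero.mp (tendsto_nhds_unique tendsto_const_nhds h4), by linear_combination -h3⟩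

theorem IsJostPlus.eq_exp {q : ℝ → ℝ} {M : Matrix (Fin 2) (Fin 2) ℝ} {S ξ : ℝ} {f : ℝ → ℂ}
    (h : IsJostPlus q M ξ f) (hξ : ξ ≠ 0) (hS : 0 < S)
    (hq0 : ∀ᵐ x : ℝ, x ∉ Set.Icc (-S) S → q x = 0) {x : ℝ} (hx : S ≤ x) :
    f x = Complex.exp (Complex.I * ξ * x) := by
  obtain ⟨⟨df, hf⟩, hlim⟩ := h
  have hξ' : (ξ : ℂ) ≠ 0 := by exact_mod_cast hξ
  obtain ⟨hA, hB⟩ := exists_exp_coeff hξ' (f S) (df S)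
  set A := (f S + df S / (Complex.I * ξ)) / 2
  set B := (f S - df S / (Complex.I * ξ)) / 2
  have hsub : Set.Ici S ⊆ Set.univ ∩ Set.Ioi 0 := fun t ht =>
    ⟨trivial, lt_of_lt_of_le hS (Set.mem_Ici.mp ht)⟩
  have hfx : ∀ x, S ≤ x → f x = A * Complex.exp (Complex.I * ξ * (x - S)) +
      B * Complex.exp (-(Complex.I * ξ * (x - S))) := fun x hx =>
    (hf.right.mono hsub).eq_exp (ae_eq_zero_of_notMem_Icc hq0).2 Set.self_mem_Ici hA.symm
      hB.symm hx
  have hlim' : Tendsto (fun x : ℝ => B * Complex.exp (Complex.I * ξ * S) *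
      Complex.exp (2 * (Complex.I * (-ξ : ℝ) * x)) + A * Complex.exp (-(Complex.I * ξ * S)))
      atTop (𝓝 1) := by
    refine hlim.congr' ?_
    filter_upwards [eventually_ge_atTop S] with x hx
    rw [hfx x hx, mul_add, mul_left_comm, ← Complex.exp_add, mul_left_comm, ← Complex.exp_add,
      mul_assoc B, ← Complex.exp_add, add_comm]
    push_cast
    congr 3 <;> ring
  obtain ⟨h1, h2⟩ := eq_zero_of_tendsto_exp (neg_ne_zero.mpr hξ)
    (fun c => tendsto_atTop_add_const_right _ c tendsto_id) hlim'
  have hB0 : B = 0 := by simpa using h1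
  rw [hfx x hx, hB0, zero_mul, add_zero, mul_sub, sub_eq_add_neg, Complex.exp_add, mul_left_comm,
    h2, mul_one]

namespace FundamentalSystem

variable {q : ℝ → ℝ} {M : Matrix (Fin 2) (Fin 2) ℝ} {S : ℝ} (F : FundamentalSystem q M S)

theorem jostMinus_eq (hq : LocallyIntegrable q volume) (hS : 0 < S)
    (hq0 : ∀ᵐ x : ℝ, x ∉ Set.Icc (-S) S → q x = 0) {ξ : ℝ} (hξ : ξ ≠ 0) {f : ℝ → ℂ}
    (h : IsJostMinus q M ξ f) {x : ℝ} (hx : 0 < x) :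
    f x = Complex.exp (Complex.I * ξ * S) * F.zj ξ x := by
  obtain ⟨⟨df, hf⟩, hlim⟩ := h
  have hξ' : (ξ : ℂ) ≠ 0 := by exact_mod_cast hξ
  obtain ⟨hA, hB⟩ := exists_exp_coeff hξ' (f (-S)) (df (-S))
  set A := (f (-S) + df (-S) / (Complex.I * ξ)) / 2
  set B := (f (-S) - df (-S) / (Complex.I * ξ)) / 2
  have hsub : Set.Iic (-S) ⊆ Set.univ ∩ Set.Iio 0 := fun t ht =>
    ⟨trivial, lt_of_le_of_lt (Set.mem_Iic.mp ht) (neg_lt_zero.mpr hS)⟩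
  have hlim' : Tendsto (fun x : ℝ => A * Complex.exp (Complex.I * ξ * S) *
      Complex.exp (2 * (Complex.I * ξ * x)) + B * Complex.exp (-(Complex.I * ξ * S)))
      atBot (𝓝 1) := by
    refine hlim.congr' ?_
    filter_upwards [eventually_le_atBot (-S)] with x hx
    rw [(hf.left.mono hsub).eq_exp (ae_eq_zero_of_notMem_Icc hq0).1 Set.self_mem_Iic hA.symm
      hB.symm hx, mul_add, mul_left_comm, ← Complex.exp_add, mul_left_comm, ← Complex.exp_add,
      mul_assoc A, ← Complex.exp_add]
    push_cast
    congr 3 <;> ring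
  obtain ⟨h1, h2⟩ := eq_zero_of_tendsto_exp hξ
    (fun c => tendsto_atBot_add_const_right _ c tendsto_id) hlim'
  have hA0 : A = 0 := by simpa using h1
  have hB1 : B = Complex.exp (Complex.I * ξ * S) := by
    rw [← mul_one (Complex.exp _), ← h2, mul_left_comm, ← Complex.exp_add]; simp
  rw [hA0] at hA hB
  have hm := (F.pair_j ξ).lincomb (F.pair_j ξ) B 0
  simp only [zero_mul, add_zero] at hm
  rw [← hB1]
  exact ((hf.eq_matchedPair hq hS (Set.mem_univ _) (Set.mem_univ _) hm
    (by rw [F.yj_left, ← hA]; ring) (by rw [F.dyj_left, ← hB]; ring)).2 x trivial hx).1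

theorem isScatteringPair_unique (hq : LocallyIntegrable q volume) (hS : 0 < S)
    (hq0 : ∀ᵐ x : ℝ, x ∉ Set.Icc (-S) S → q x = 0) {ξ : ℝ} (hξ : ξ ≠ 0) {A B : ℂ}
    (h : IsScatteringPair q M ξ A B) :
    A = Complex.exp (2 * (Complex.I * ξ * S)) * F.P ξ / (2 * (Complex.I * ξ)) ∧
      B = F.Q ξ / (2 * (Complex.I * ξ)) := by
  obtain ⟨fm, fp, fpc, hm, hp, hpc, hrel⟩ := h
  have hξ' : (ξ : ℂ) ≠ 0 := by exact_mod_cast hξ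
  -- This is the difference of the two sides of the scattering relation times e^{iξx}. It vanishes
  -- identically beyond S, which allows the coefficients to be compared.
  have hlim : Tendsto (fun x : ℝ => (F.Q ξ / (2 * (Complex.I * ξ)) - B) *
      Complex.exp (2 * (Complex.I * ξ * x)) +
      (Complex.exp (2 * (Complex.I * ξ * S)) * F.P ξ / (2 * (Complex.I * ξ)) - A))
      atTop (𝓝 0) := by
    refine tendsto_const_nhds.congr' ?_
    filter_upwards [eventually_ge_atTop S] with x hx
    have hx0 : 0 < x := lt_of_lt_of_le hS hx
    have h1 := hrel x hx0.ne'
    rw [F.jostMinus_eq hq hS hq0 hξ hm hx0, F.zj_eq_exp hq0 hξ' hx, hp.eq_exp hξ hS hq0 hx,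
      hpc.eq_exp (neg_ne_zero.mpr hξ) hS hq0 hx] at h1
    have e1 : Complex.exp (Complex.I * ξ * (x - S)) =
        Complex.exp (Complex.I * ξ * x) * (Complex.exp (Complex.I * ξ * S))⁻¹ := by
      rw [← Complex.exp_neg, ← Complex.exp_add]; ring_nf
    have e2 : Complex.exp (-(Complex.I * ξ * (x - S))) =
        (Complex.exp (Complex.I * ξ * x))⁻¹ * Complex.exp (Complex.I * ξ * S) := by
      rw [← Complex.exp_neg, ← Complex.exp_add]; ring_nf
    have e3 : Complex.exp (Complex.I * (-ξ : ℝ) * x) = (Complex.exp (Complex.I * ξ * x))⁻¹ := by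
      rw [← Complex.exp_neg]; push_cast; ring_nf
    have e4 : ∀ w : ℂ, Complex.exp (2 * w) = Complex.exp w ^ 2 := fun w => by
      rw [← Complex.exp_nat_mul]; norm_num
    have hE := Complex.exp_ne_zero (Complex.I * ξ * x)
    have hE' := Complex.exp_ne_zero (Complex.I * ξ * S)
    rw [e1, e2, e3] at h1
    rw [e4, e4]
    have h2 := congrArg (fun w => w * Complex.exp (Complex.I * ξ * x)) h1
    field_simp at h2 ⊢
    linear_combination -h2
  obtain ⟨h1, h2⟩ := eq_zero_of_tendsto_exp hξ
    (fun c => tendsto_atTop_add_const_right _ c tendsto_id) hlim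
  exact ⟨by linear_combination -h2, by linear_combination -h1⟩

theorem exists_isJostPlus (F : FundamentalSystem q M S) (hq : LocallyIntegrable q volume)
    (hM : M.det = 1) (hS : 0 < S) (hq0 : ∀ᵐ x : ℝ, x ∉ Set.Icc (-S) S → q x = 0) (ξ : ℝ) :
    ∃ y dy z dz : ℝ → ℂ, IsMatchedPair q M ((ξ : ℂ) ^ 2) y dy z dz ∧
      z S = Complex.exp (Complex.I * ξ * S) ∧
      dz S = Complex.I * ξ * Complex.exp (Complex.I * ξ * S) ∧
      IsJostPlus q M ξ fun x => if x < 0 then y x else z x := by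
  obtain ⟨y, dy, z, dz, h, h1, h2⟩ := F.exists_isMatchedPair_right hq hM ((ξ : ℂ) ^ 2)
    (Complex.exp (Complex.I * ξ * S)) (Complex.I * ξ * Complex.exp (Complex.I * ξ * S))
  refine ⟨y, dy, z, dz, h, h1, h2, ⟨_, h.isTransferSolution _⟩, ?_⟩
  refine tendsto_const_nhds.congr' ?_
  filter_upwards [eventually_ge_atTop S] with x hx
  rw [if_neg (by linarith), (h.right.mono (Set.subset_univ (Set.Ici S))).eq_exp
    (ae_eq_zero_of_notMem_Icc hq0).2 (c := S) Set.self_mem_Ici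
    (A := Complex.exp (Complex.I * ξ * S)) (B := 0) (by rw [h1]; ring) (by rw [h2]; ring) hx,
    zero_mul, add_zero, ← Complex.exp_add, ← Complex.exp_add, ← Complex.exp_zero]
  congr 1; ring

theorem exists_isScatteringPair (hq : LocallyIntegrable q volume) (hM : M.det = 1) (hS : 0 < S)
    (hq0 : ∀ᵐ x : ℝ, x ∉ Set.Icc (-S) S → q x = 0) {ξ : ℝ} (hξ : ξ ≠ 0) :
    IsScatteringPair q M ξ
      (Complex.exp (2 * (Complex.I * ξ * S)) * F.P ξ / (2 * (Complex.I * ξ)))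
      (F.Q ξ / (2 * (Complex.I * ξ))) := by
  have hξ' : (ξ : ℂ) ≠ 0 := by exact_mod_cast hξ
  have hI := Complex.I_ne_zero
  obtain ⟨y, dy, z, dz, h, h1, h2, hj⟩ := F.exists_isJostPlus hq hM hS hq0 ξ
  obtain ⟨y', dy', z', dz', h', h1', h2', hj'⟩ := F.exists_isJostPlus hq hM hS hq0 (-ξ)
  have hm := (F.pair_j ξ).lincomb (F.pair_j ξ) (Complex.exp (Complex.I * ξ * S)) 0
  simp only [zero_mul, add_zero] at hm
  refine ⟨_, _, _, ⟨⟨_, hm.isTransferSolution _⟩, ?_⟩, hj, hj', fun x hx => ?_⟩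
  · refine tendsto_const_nhds.congr' ?_
    filter_upwards [eventually_le_atBot (-S)] with x hx
    rw [if_pos (by linarith), F.yj_eq_exp hq0 _ hx, ← Complex.exp_add, ← Complex.exp_add,
      ← Complex.exp_zero]
    congr 1; push_cast; ring
  · have hc : ((-ξ : ℝ) : ℂ) ^ 2 = (ξ : ℂ) ^ 2 := by push_cast; ring
    rw [hc] at h'
    have hE := Complex.exp_ne_zero (Complex.I * ξ * S)
    have e3 : Complex.exp (Complex.I * (-ξ : ℝ) * S) = (Complex.exp (Complex.I * ξ * S))⁻¹ := by
      rw [← Complex.exp_neg]; push_cast; ring_nf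
    have e4 : Complex.exp (2 * (Complex.I * ξ * S)) = Complex.exp (Complex.I * ξ * S) ^ 2 := by
      rw [← Complex.exp_nat_mul]; norm_num
    rw [e3] at h1' h2'
    have := F.eq_of_eq_right hq hM hm (h'.lincomb h
      (Complex.exp (2 * (Complex.I * ξ * S)) * F.P ξ / (2 * (Complex.I * ξ)))
      (F.Q ξ / (2 * (Complex.I * ξ))))
      (by rw [h1', h1, e4, P, Q]; field_simp; ring)
      (by rw [h2', h2, e4, P, Q]; push_cast; field_simp; ring) x
    rcases lt_or_gt_of_ne hx with hx' | hx'
    · simp only [if_pos hx']; exact this.1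
    · simp only [if_neg (not_lt.mpr hx'.le)]; exact this.2

/-- Existence of a scattering pair keeps `reflectionCoeff` away from its default value 0, and
uniqueness identifies the pair that was chosen. -/
theorem reflectionCoeff_eq (hq : LocallyIntegrable q volume) (hM : M.det = 1) (hS : 0 < S)
    (hq0 : ∀ᵐ x : ℝ, x ∉ Set.Icc (-S) S → q x = 0) {ξ : ℝ} (hξ : ξ ≠ 0) :
    reflectionCoeff q M ξ = Complex.exp (-(2 * (Complex.I * ξ * S))) * (F.Q ξ / F.P ξ) := by
  have hξ' : (ξ : ℂ) ≠ 0 := by exact_mod_cast hξ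
  have hI := Complex.I_ne_zero
  have hP := F.P_ofReal_ne_zero hq hM hS.le hξ
  have hex : ∃ r A B : ℂ, IsScatteringPair q M ξ A B ∧ r = B / A :=
    ⟨_, _, _, F.exists_isScatteringPair hq hM hS hq0 hξ, rfl⟩
  rw [reflectionCoeff, dif_pos hex]
  obtain ⟨A, B, hAB, hr⟩ := hex.choose_spec
  obtain ⟨hA, hB⟩ := F.isScatteringPair_unique hq hS hq0 hξ hAB
  have hE := Complex.exp_ne_zero (2 * (Complex.I * ξ * S))
  rw [hr, hA, hB, Complex.exp_neg]
  field_simp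

end FundamentalSystem

/-! ### Asymptotics for large spectral parameter -/

/-- Comparison of a solution with the exponentials `e^{∓iζx}` for `ζ` in the closed upper
half-plane. -/
theorem IsSolutionOn.exp_bounds {q : ℝ → ℝ} (hq : LocallyIntegrable q volume) {ζ : ℂ}
    {y dy : ℝ → ℂ} (h : IsSolutionOn q (ζ ^ 2) Set.univ y dy) (hζ : 0 ≤ ζ.im) {a b K : ℝ}
    (hab : a ≤ b) (hK : ∫ x in a..b, |q x| ≤ K) (hKζ : 2 * K ≤ ‖ζ‖) {p s : ℝ → ℂ}
    (hp : ∀ x, p x = Complex.exp (Complex.I * ζ * x) * (Complex.I * ζ * y x - dy x))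
    (hs : ∀ x, s x = Complex.exp (Complex.I * ζ * x) * (Complex.I * ζ * y x + dy x)) :
    ‖ζ‖ * ‖p b - p a‖ ≤ K * (‖p a‖ + ‖s a‖) ∧
      ‖ζ‖ * ‖s b‖ ≤ ‖ζ‖ * ‖s a‖ + K * (‖p a‖ + ‖s a‖) := by
  let e : ℝ → ℂ := fun x => Complex.exp (Complex.I * ζ * x)
  have hqI := fun u v => hq.intervalIntegrable_real u v
  have hyc := h.continuous
  have hec : Continuous e := by fun_prop
  obtain ⟨t₀, ht₀, hmax⟩ := isCompact_Icc.exists_isMaxOn (Set.nonempty_Icc.mpr hab)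
    (f := fun x => ‖e x * y x‖) (by fun_prop)
  -- For q = 0 the function p is constant and s is a multiple of e^{2iζx}. The deviation of both is
  -- at most K times the maximum m of |e^{iζx} y|.
  set m := ‖e t₀ * y t₀‖ with hm
  have hm0 : 0 ≤ m := norm_nonneg _
  have hint : ∀ x ∈ Set.Icc a b, ∀ r : ℝ → ℂ, (∀ t ∈ Set.Ioc a x, ‖r t‖ ≤ |q t| * m) →
      ‖∫ t in a..x, r t‖ ≤ K * m := fun x hx r hr => by
    have h1 : ‖∫ t in a..x, r t‖ ≤ ∫ t in a..x, |q t| * m :=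
      intervalIntegral.norm_integral_le_of_norm_le hx.1
        (Eventually.of_forall fun t ht => hr t ht) ((hqI a x).abs.mul_const m)
    have h2 : ∫ t in a..x, |q t| ≤ ∫ t in a..b, |q t| :=
      intervalIntegral.integral_mono_interval le_rfl hx.1 hx.2
        (Eventually.of_forall fun t => abs_nonneg _) (hqI a b).abs
    rw [intervalIntegral.integral_mul_const] at h1
    exact h1.trans (mul_le_mul_of_nonneg_right (h2.trans hK) hm0)
  have hpx : ∀ x ∈ Set.Icc a b, ‖p x - p a‖ ≤ K * m := fun x hx => by
    have h1 := (h.mono (Set.subset_univ (Set.uIcc a x))).wronskian (hqI a x)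
      ((locallyIntegrable_const (0 : ℝ)).intervalIntegrable_real a x)
      ((isSolutionOn_exp ζ 0).mono (Set.subset_univ _))
    have h2 : p x - p a = ∫ t in a..x, ((0 : ℝ) - (q t : ℂ) + (ζ ^ 2 - ζ ^ 2)) *
        (y t * Complex.exp (Complex.I * ζ * (t - (0 : ℝ)))) := by
      rw [h1, hp, hp]; simp only [Complex.ofReal_zero, sub_zero]; ring
    rw [h2]
    refine hint x hx _ fun t ht => ?_
    have h3 : ‖e t * y t‖ ≤ m := hmax ⟨ht.1.le, ht.2.trans hx.2⟩
    simp only [Complex.ofReal_zero, sub_zero, zero_sub, sub_self, add_zero]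
    rw [norm_mul, norm_neg, Complex.norm_real, Real.norm_eq_abs, mul_comm (y t)]
    exact mul_le_mul_of_nonneg_left h3 (abs_nonneg _)
  have hsx : ∀ x ∈ Set.Icc a b, ‖s x‖ ≤ ‖s a‖ + K * m := fun x hx => by
    have h0 := isSolutionOn_exp (-ζ) x
    rw [neg_sq] at h0
    have h1 := (h.mono (Set.subset_univ (Set.uIcc a x))).wronskian (hqI a x)
      ((locallyIntegrable_const (0 : ℝ)).intervalIntegrable_real a x)
      (h0.mono (Set.subset_univ _))
    -- The growing comparison exponential is rewritten through e^{2iζ(x-t)}, which has modulus at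
    -- most one for t ≤ x and Im ζ ≥ 0.
    have e1 : ∀ t : ℝ, e x * Complex.exp (Complex.I * -ζ * (t - x)) =
        Complex.exp (Complex.I * ζ * (2 * (x - t) : ℝ)) * e t := fun t => by
      simp only [e, ← Complex.exp_add]; push_cast; ring_nf
    have h2 : s x = Complex.exp (Complex.I * ζ * (2 * (x - a) : ℝ)) * s a -
        e x * ∫ t in a..x, ((0 : ℝ) - (q t : ℂ) + (ζ ^ 2 - ζ ^ 2)) *
        (y t * Complex.exp (Complex.I * -ζ * (t - x))) := by
      have e2 := e1 a
      rw [h1, hs, hs]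
      simp only [sub_self, mul_zero, Complex.exp_zero, mul_one]
      simp only [e] at e2 ⊢
      linear_combination (Complex.I * ζ * y a + dy a) * e2
    have hle : ∀ t ∈ Set.Icc a x, ‖Complex.exp (Complex.I * ζ * (2 * (x - t) : ℝ))‖ ≤ 1 :=
      fun t ht => by
        rw [norm_exp_I_mul, Real.exp_le_one_iff]
        have : 0 ≤ x - t := sub_nonneg.mpr ht.2
        have : 0 ≤ ζ.im * (2 * (x - t)) := by positivity
        linarith
    rw [h2, ← intervalIntegral.integral_const_mul]
    refine (norm_sub_le _ _).trans (add_le_add ?_ (hint x hx _ fun t ht => ?_))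
    · rw [norm_mul]
      exact mul_le_of_le_one_left (norm_nonneg _) (hle a ⟨le_rfl, hx.1⟩)
    · have h3 : ‖e t * y t‖ ≤ m := hmax ⟨ht.1.le, ht.2.trans hx.2⟩
      simp only [Complex.ofReal_zero, zero_sub, sub_self, add_zero]
      have h4 : e x * (-(q t : ℂ) * (y t * Complex.exp (Complex.I * -ζ * (t - x)))) =
          -(q t : ℂ) * (Complex.exp (Complex.I * ζ * (2 * (x - t) : ℝ)) * (e t * y t)) := by
        linear_combination (-(q t : ℂ) * y t) * e1 t
      rw [h4, norm_mul, norm_neg, Complex.norm_real, Real.norm_eq_abs, norm_mul]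
      refine mul_le_mul_of_nonneg_left ?_ (abs_nonneg _)
      exact (mul_le_of_le_one_left (norm_nonneg _) (hle t ⟨ht.1.le, ht.2⟩)).trans h3
  -- Since 2iζ e y = p + s, the maximum m is bounded in terms of p and s, whose bounds again contain
  -- m; 2K ≤ |ζ| lets that term be absorbed.
  have hmN : ‖ζ‖ * m ≤ ‖p a‖ + ‖s a‖ := by
    have h1 : 2 * (Complex.I * ζ) * (e t₀ * y t₀) = p t₀ + s t₀ := by
      rw [hp, hs]; simp only [e]; ring
    have h2 : 2 * ‖ζ‖ * m ≤ ‖p t₀‖ + ‖s t₀‖ := by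
      have := norm_add_le (p t₀) (s t₀)
      rw [← h1] at this
      simpa [hm] using this
    have h3 : ‖p t₀‖ ≤ ‖p a‖ + K * m := by
      have := norm_add_le (p a) (p t₀ - p a)
      rw [add_sub_cancel] at this
      linarith [hpx t₀ ht₀]
    have h4 := hsx t₀ ht₀
    have h5 : 2 * K * m ≤ ‖ζ‖ * m := mul_le_mul_of_nonneg_right hKζ hm0
    linarith
  have hK0 : 0 ≤ K := (intervalIntegral.integral_nonneg hab fun x _ => abs_nonneg (q x)).trans hK
  have hKm : ‖ζ‖ * (K * m) ≤ K * (‖p a‖ + ‖s a‖) := by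
    rw [mul_left_comm]; exact mul_le_mul_of_nonneg_left hmN hK0
  have hb : b ∈ Set.Icc a b := ⟨hab, le_rfl⟩
  constructor
  · exact (mul_le_mul_of_nonneg_left (hpx b hb) (norm_nonneg _)).trans hKm
  · have := mul_le_mul_of_nonneg_left (hsx b hb) (norm_nonneg ζ)
    linarith

/-- To leading order y(0⁻) = 1/(2iζ) and y'(0⁻) = -1/2. Applying M gives the main term, the
contribution of M 1 0 being of order 1/|ζ|, and the right half-interval preserves it up to a
relative error of order 1/|ζ|. As the data at 0⁺ are of size |ζ| |M 0 1| + 1, the total error is of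
order |M 0 1| + 1/|ζ|. -/
theorem IsMatchedPair.asymptotics {q : ℝ → ℝ} (hq : LocallyIntegrable q volume)
    {M : Matrix (Fin 2) (Fin 2) ℝ} {S K : ℝ} (hS : 0 ≤ S) (hK1 : ∫ x in (-S)..0, |q x| ≤ K)
    (hK2 : ∫ x in (0 : ℝ)..S, |q x| ≤ K) {ζ : ℂ} (hζ : 0 ≤ ζ.im) (hKζ : 2 * K ≤ ‖ζ‖)
    (h1ζ : 1 ≤ ‖ζ‖) {y dy z dz : ℝ → ℂ} (h : IsMatchedPair q M (ζ ^ 2) y dy z dz)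
    (hp : Complex.exp (Complex.I * ζ * (-S : ℝ)) * (Complex.I * ζ * y (-S) - dy (-S)) = 1)
    (hs : Complex.I * ζ * y (-S) + dy (-S) = 0) :
    ‖Complex.exp (Complex.I * ζ * S) * (Complex.I * ζ * z S - dz S) -
      (M 0 0 + M 1 1 - Complex.I * ζ * M 0 1) / 2‖ ≤
      (3 * K * (1 + |M 0 0| + |M 1 0| + |M 1 1|) + |M 1 0|) * (|M 0 1| + 1 / ‖ζ‖) := by
  have hz0 : (0 : ℝ) < ‖ζ‖ := by linarith
  have hK0 : 0 ≤ K :=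
    (intervalIntegral.integral_nonneg hS fun x _ => abs_nonneg (q x)).trans hK2
  obtain ⟨h1, h2⟩ := h.left.exp_bounds hq hζ (by linarith : -S ≤ 0) hK1 hKζ
    (fun _ => rfl) (fun _ => rfl)
  obtain ⟨h3, -⟩ := h.right.exp_bounds hq hζ hS hK2 hKζ (fun _ => rfl) (fun _ => rfl)
  rw [hp, hs] at h1 h2
  simp only [Complex.ofReal_zero, mul_zero, Complex.exp_zero, one_mul, norm_one, norm_zero,
    add_zero, zero_add, mul_one] at h1 h2 h3
  set A := y 0
  set B := dy 0
  set Z := z 0 with hZ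
  set W := dz 0 with hW
  set π := Complex.I * ζ * A - B
  set σ := Complex.I * ζ * A + B
  rw [h.match_zero] at hZ
  rw [h.match_deriv] at hW
  have hζne : ζ ≠ 0 := norm_pos_iff.mp hz0
  have hI := Complex.I_ne_zero
  have hIζ : ‖Complex.I * ζ‖ = ‖ζ‖ := by simp
  set κ := K / ‖ζ‖ with hκ
  have hκ0 : 0 ≤ κ := by positivity
  have hκ2 : κ ≤ 1 / 2 := by rw [hκ, div_le_iff₀ hz0]; linarith
  have hπ : ‖π - 1‖ ≤ κ := by rw [hκ, le_div_iff₀ hz0]; linarith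
  have hσ : ‖σ‖ ≤ κ := by rw [hκ, le_div_iff₀ hz0]; linarith
  have hπ' : ‖π‖ ≤ 1 + κ := by
    have := norm_add_le (π - 1) 1
    rw [sub_add_cancel, norm_one] at this
    linarith
  have hA : Complex.I * ζ * A = (π + σ) / 2 := by simp only [π, σ]; ring
  have hB : B = (σ - π) / 2 := by simp only [π, σ]; ring
  have hA1 : ‖ζ‖ * ‖A‖ ≤ 1 := by
    have := congrArg norm hA
    rw [norm_mul, hIζ, norm_div, Complex.norm_ofNat] at this
    have h4 := norm_add_le π σ
    rw [this]; linarith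
  have hB1 : ‖B‖ ≤ 1 := by
    rw [hB, norm_div, Complex.norm_ofNat]
    have h4 := norm_sub_le σ π
    linarith
  have hr : ∀ r : ℝ, ‖(r : ℂ)‖ = |r| := fun r => by rw [Complex.norm_real, Real.norm_eq_abs]
  have hZn : ‖ζ‖ * ‖Z‖ ≤ |M 0 0| + ‖ζ‖ * |M 0 1| := by
    have h4 := norm_add_le ((M 0 0 : ℂ) * A) ((M 0 1 : ℂ) * B)
    rw [← hZ, norm_mul, norm_mul, hr, hr] at h4
    have h5 := mul_le_mul_of_nonneg_left h4 hz0.le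
    have h6 := mul_le_mul_of_nonneg_left hA1 (abs_nonneg (M 0 0))
    have h7 := mul_le_mul_of_nonneg_left hB1 (mul_nonneg hz0.le (abs_nonneg (M 0 1)))
    linarith
  have hWn : ‖W‖ ≤ |M 1 0| + |M 1 1| := by
    have h4 := norm_add_le ((M 1 0 : ℂ) * A) ((M 1 1 : ℂ) * B)
    rw [← hW, norm_mul, norm_mul, hr, hr] at h4
    have hA2 : ‖A‖ ≤ 1 := by nlinarith [norm_nonneg A]
    have h6 := mul_le_mul_of_nonneg_left hA2 (abs_nonneg (M 1 0))
    have h7 := mul_le_mul_of_nonneg_left hB1 (abs_nonneg (M 1 1))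
    linarith
  have hN : ‖Complex.I * ζ * Z - W‖ + ‖Complex.I * ζ * Z + W‖ ≤
      2 * (|M 0 0| + ‖ζ‖ * |M 0 1| + |M 1 0| + |M 1 1|) := by
    have h4 := norm_sub_le (Complex.I * ζ * Z) W
    have h5 := norm_add_le (Complex.I * ζ * Z) W
    rw [norm_mul, hIζ] at h4 h5
    linarith
  have hfirst : ‖Complex.exp (Complex.I * ζ * S) * (Complex.I * ζ * z S - dz S) -
      (Complex.I * ζ * Z - W)‖ ≤
      2 * K * |M 0 1| + 2 * K * (|M 0 0| + |M 1 0| + |M 1 1|) * (1 / ‖ζ‖) := by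
    have h4 := h3.trans (mul_le_mul_of_nonneg_left hN hK0)
    rw [← le_div_iff₀' hz0] at h4
    refine h4.trans_eq ?_
    field_simp
    ring
  have hsecond : ‖(Complex.I * ζ * Z - W) - (M 0 0 + M 1 1 - Complex.I * ζ * M 0 1) / 2‖ ≤
      K * |M 0 1| + (K * (|M 0 0| + |M 1 1|) + |M 1 0|) * (1 / ‖ζ‖) := by
    have h4 : (Complex.I * ζ * Z - W) - (M 0 0 + M 1 1 - Complex.I * ζ * M 0 1) / 2 =
        M 0 0 * ((π - 1) + σ) / 2 + M 0 1 * (Complex.I * ζ) * (σ - (π - 1)) / 2 +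
        (-(M 1 0 * A) - M 1 1 * (σ - (π - 1)) / 2) := by
      rw [hZ, hW]
      simp only [π, σ]
      ring
    have hp1 : ‖(π - 1) + σ‖ ≤ 2 * κ := (norm_add_le _ _).trans (by linarith)
    have hp2 : ‖σ - (π - 1)‖ ≤ 2 * κ := (norm_sub_le _ _).trans (by linarith)
    have t1 : ‖(M 0 0 : ℂ) * ((π - 1) + σ) / 2‖ ≤ |M 0 0| * κ := by
      rw [norm_div, norm_mul, hr, Complex.norm_ofNat]
      have := mul_le_mul_of_nonneg_left hp1 (abs_nonneg (M 0 0))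
      linarith
    have t2 : ‖(M 0 1 : ℂ) * (Complex.I * ζ) * (σ - (π - 1)) / 2‖ ≤ |M 0 1| * ‖ζ‖ * κ := by
      rw [norm_div, norm_mul, norm_mul, hr, hIζ, Complex.norm_ofNat]
      have := mul_le_mul_of_nonneg_left hp2 (mul_nonneg (abs_nonneg (M 0 1)) hz0.le)
      linarith
    have t3 : ‖(M 1 1 : ℂ) * (σ - (π - 1)) / 2‖ ≤ |M 1 1| * κ := by
      rw [norm_div, norm_mul, hr, Complex.norm_ofNat]
      have := mul_le_mul_of_nonneg_left hp2 (abs_nonneg (M 1 1))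
      linarith
    have t4 : ‖-((M 1 0 : ℂ) * A)‖ ≤ |M 1 0| * (1 / ‖ζ‖) := by
      rw [norm_neg, norm_mul, hr]
      refine mul_le_mul_of_nonneg_left ?_ (abs_nonneg _)
      rw [le_div_iff₀ hz0]; linarith
    rw [h4]
    have t5 := (norm_add_le _ _).trans (add_le_add ((norm_add_le _ _).trans (add_le_add t1 t2))
      ((norm_sub_le _ _).trans (add_le_add t4 t3)))
    refine t5.trans_eq ?_
    rw [hκ]; field_simp; ring
  have hsum := norm_add_le (Complex.exp (Complex.I * ζ * S) * (Complex.I * ζ * z S - dz S) -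
    (Complex.I * ζ * Z - W))
    ((Complex.I * ζ * Z - W) - (M 0 0 + M 1 1 - Complex.I * ζ * M 0 1) / 2)
  rw [sub_add_sub_cancel] at hsum
  refine hsum.trans ((add_le_add hfirst hsecond).trans ?_)
  have hi : 0 ≤ 1 / ‖ζ‖ := by positivity
  have g1 : 0 ≤ K * (|M 0 0| + |M 1 0| + |M 1 1|) * |M 0 1| := by positivity
  have g2 : 0 ≤ K * (1 / ‖ζ‖) := by positivity
  have g3 : 0 ≤ K * |M 1 0| * (1 / ‖ζ‖) := by positivity
  have g4 : 0 ≤ |M 1 0| * |M 0 1| := by positivity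
  linarith

namespace FundamentalSystem

variable {q : ℝ → ℝ} {M : Matrix (Fin 2) (Fin 2) ℝ} {S : ℝ} (F : FundamentalSystem q M S)

theorem P_asymptotics (hq : LocallyIntegrable q volume) (hS : 0 ≤ S) :
    ∃ C : ℝ, 0 ≤ C ∧ ∀ ζ : ℂ, 0 ≤ ζ.im → C ≤ ‖ζ‖ → 1 ≤ ‖ζ‖ →
      ‖F.P ζ / (2 * (Complex.I * ζ) * Complex.exp (-(2 * (Complex.I * ζ * S)))) -
        (M 0 0 + M 1 1 - Complex.I * ζ * M 0 1) / 2‖ ≤ C * (|M 0 1| + 1 / ‖ζ‖) := by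
  set K1 := ∫ x in (-S)..0, |q x|
  set K2 := ∫ x in (0 : ℝ)..S, |q x|
  have hK1 : 0 ≤ K1 :=
    intervalIntegral.integral_nonneg (by linarith) fun x _ => abs_nonneg (q x)
  have hK2 : 0 ≤ K2 := intervalIntegral.integral_nonneg hS fun x _ => abs_nonneg (q x)
  set K := K1 + K2
  have hK : 0 ≤ K := add_nonneg hK1 hK2
  refine ⟨3 * K * (1 + |M 0 0| + |M 1 0| + |M 1 1|) + |M 1 0|, by positivity,
    fun ζ hζ hC h1 => ?_⟩
  have hKζ : 2 * K ≤ ‖ζ‖ := by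
    have : 0 ≤ K * (|M 0 0| + |M 1 0| + |M 1 1|) := by positivity
    linarith [abs_nonneg (M 1 0)]
  have hζ0 : ζ ≠ 0 := norm_pos_iff.mp (by linarith)
  have hI := Complex.I_ne_zero
  set E := Complex.exp (Complex.I * ζ * S) with hE
  have hE0 : E ≠ 0 := Complex.exp_ne_zero _
  have e1 : Complex.exp (-(2 * (Complex.I * ζ * S))) = (E ^ 2)⁻¹ := by
    rw [hE, ← Complex.exp_nat_mul, ← Complex.exp_neg]; norm_num
  have e2 : Complex.exp (Complex.I * ζ * (-S : ℝ)) = E⁻¹ := by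
    rw [hE, ← Complex.exp_neg]; push_cast; ring_nf
  have hm := (F.pair_j ζ).lincomb (F.pair_j ζ) (E / (2 * (Complex.I * ζ))) 0
  have := hm.asymptotics hq hS (le_add_of_nonneg_right hK2 : K1 ≤ K)
    (le_add_of_nonneg_left hK1 : K2 ≤ K) hζ hKζ h1
    (by rw [e2, F.yj_left, F.dyj_left]; field_simp; ring)
    (by rw [F.yj_left, F.dyj_left]; ring)
  convert this using 3
  rw [e1, P]
  field_simp
  ring

/-- In the closed upper half-plane `P` has the size of a power of `ζ`, up to an elementary
factor. -/
theorem exists_P_growth (hq : LocallyIntegrable q volume) (hM : M.det = 1) (hS : 0 ≤ S) :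
    ∃ (n : ℕ) (c C R : ℝ), 0 < c ∧ 0 < C ∧ ∀ ζ : ℂ, 0 ≤ ζ.im → R ≤ ‖ζ‖ →
      c * ‖ζ‖ ^ n * ‖2 * (Complex.I * ζ) * Complex.exp (-(2 * (Complex.I * ζ * S)))‖ ≤ ‖F.P ζ‖ ∧
      ‖F.P ζ‖ ≤
        C * ‖ζ‖ ^ n * ‖2 * (Complex.I * ζ) * Complex.exp (-(2 * (Complex.I * ζ * S)))‖ := by
  obtain ⟨C, hC, hbound⟩ := F.P_asymptotics hq hS
  suffices H : ∃ (n : ℕ) (c C' R : ℝ), 0 < c ∧ 0 < C' ∧ 1 ≤ R ∧ ∀ ζ G : ℂ, R ≤ ‖ζ‖ → C ≤ ‖ζ‖ →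
      ‖G - (M 0 0 + M 1 1 - Complex.I * ζ * M 0 1) / 2‖ ≤ C * (|M 0 1| + 1 / ‖ζ‖) →
      c * ‖ζ‖ ^ n ≤ ‖G‖ ∧ ‖G‖ ≤ C' * ‖ζ‖ ^ n by
    obtain ⟨n, c, C', R, hc, hC', hR1, H⟩ := H
    refine ⟨n, c, C', max R C, hc, hC', fun ζ hζ hR => ?_⟩
    have hR' := (le_max_left _ _).trans hR
    obtain ⟨h1, h2⟩ := H ζ _ hR' ((le_max_right _ _).trans hR)
      (hbound ζ hζ ((le_max_right _ _).trans hR) (hR1.trans hR'))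
    have hζ0 : ζ ≠ 0 := norm_pos_iff.mp (by linarith)
    have hpos : 0 < ‖2 * (Complex.I * ζ) * Complex.exp (-(2 * (Complex.I * ζ * S)))‖ := by
      rw [norm_pos_iff]
      exact mul_ne_zero (mul_ne_zero two_ne_zero (mul_ne_zero Complex.I_ne_zero hζ0))
        (Complex.exp_ne_zero _)
    rw [norm_div, le_div_iff₀ hpos] at h1
    rw [norm_div, div_le_iff₀ hpos] at h2
    exact ⟨h1, h2⟩
  have hr : ∀ r : ℝ, ‖(r : ℂ)‖ = |r| := fun r => by rw [Complex.norm_real, Real.norm_eq_abs]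
  -- If M 0 1 is nonzero, the term -iζ M 0 1 / 2 dominates and the exponent is 1. Otherwise half the
  -- trace dominates with exponent 0; it is nonzero because det M = M 0 0 * M 1 1 = 1.
  by_cases h01 : M 0 1 = 0
  · set L : ℂ := (M 0 0 + M 1 1) / 2 with hL
    have hL0 : L ≠ 0 := by
      intro h0
      have h1 : M 0 0 + M 1 1 = 0 := by
        have : (M 0 0 : ℂ) + M 1 1 = 0 := by linear_combination 2 * h0
        exact_mod_cast this
      rw [Matrix.det_fin_two, h01, eq_neg_of_add_eq_zero_right h1] at hM
      nlinarith [sq_nonneg (M 0 0)]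
    have hLp : 0 < ‖L‖ := norm_pos_iff.mpr hL0
    refine ⟨0, ‖L‖ / 2, 2 * ‖L‖, max 1 (2 * C / ‖L‖), by positivity, by positivity,
      le_max_left _ _, fun ζ G hR _ hG => ?_⟩
    have h1ζ : 1 ≤ ‖ζ‖ := (le_max_left _ _).trans hR
    have h2ζ : 2 * C / ‖L‖ ≤ ‖ζ‖ := (le_max_right _ _).trans hR
    rw [div_le_iff₀ hLp] at h2ζ
    simp only [h01, Complex.ofReal_zero, mul_zero, sub_zero, abs_zero, zero_add] at hG
    rw [← hL] at hG
    have h3 : C * (1 / ‖ζ‖) ≤ ‖L‖ / 2 := by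
      rw [mul_one_div, div_le_iff₀ (by linarith)]; linarith
    have h4 := norm_add_le (G - L) L
    have h5 := norm_sub_le G (G - L)
    rw [sub_add_cancel] at h4
    rw [sub_sub_cancel] at h5
    rw [pow_zero, mul_one, mul_one]
    constructor <;> linarith
  · set μ := |M 0 1| with hμ
    have hμp : 0 < μ := abs_pos.mpr h01
    set D := |M 0 0| + |M 1 1| + C * (μ + 1) with hD
    have hD0 : 0 ≤ D := by positivity
    refine ⟨1, μ / 4, μ + D, max 1 (4 * D / μ), by positivity, by positivity,
      le_max_left _ _, fun ζ G hR _ hG => ?_⟩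
    have h1ζ : 1 ≤ ‖ζ‖ := (le_max_left _ _).trans hR
    have h2ζ : 4 * D / μ ≤ ‖ζ‖ := (le_max_right _ _).trans hR
    rw [div_le_iff₀ hμp] at h2ζ
    have h3 : C * (μ + 1 / ‖ζ‖) ≤ C * (μ + 1) := by
      gcongr
      rw [div_le_one (by linarith)]; exact h1ζ
    have h6 : ‖(M 0 0 : ℂ) + M 1 1‖ ≤ |M 0 0| + |M 1 1| := by
      have := norm_add_le (M 0 0 : ℂ) (M 1 1 : ℂ)
      rwa [hr, hr] at this
    have h7 : ‖G - -(Complex.I * ζ * M 0 1) / 2‖ ≤ D := by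
      have := norm_add_le (G - (M 0 0 + M 1 1 - Complex.I * ζ * M 0 1) / 2)
        (((M 0 0 : ℂ) + M 1 1) / 2)
      rw [norm_div, Complex.norm_ofNat] at this
      have h8 : G - (M 0 0 + M 1 1 - Complex.I * ζ * M 0 1) / 2 + ((M 0 0 : ℂ) + M 1 1) / 2 =
        G - -(Complex.I * ζ * M 0 1) / 2 := by ring
      rw [h8] at this
      linarith [abs_nonneg (M 0 0), abs_nonneg (M 1 1)]
    have h9 : ‖-(Complex.I * ζ * M 0 1) / 2‖ = ‖ζ‖ * μ / 2 := by
      rw [norm_div, norm_neg, norm_mul, norm_mul, hr, Complex.norm_I, Complex.norm_ofNat, one_mul]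
    have h4 := norm_add_le (G - -(Complex.I * ζ * M 0 1) / 2) (-(Complex.I * ζ * M 0 1) / 2)
    have h5 := norm_sub_le G (G - -(Complex.I * ζ * M 0 1) / 2)
    rw [sub_add_cancel, h9] at h4
    rw [sub_sub_cancel, h9] at h5
    rw [pow_one]
    constructor
    · linarith
    · nlinarith

end FundamentalSystem

/-! ### Quotients of entire functions in the upper half-plane -/

/-- The quotient of two functions, with simple common zeros cancelled. -/
noncomputable def regularQuotient (f g : ℂ → ℂ) (z : ℂ) : ℂ :=
  open Classical in if g z = 0 then deriv f z / deriv g z else f z / g z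

theorem differentiable_dslope {f : ℂ → ℂ} (hf : Differentiable ℂ f)
    (z : ℂ) : Differentiable ℂ (dslope f z) := fun _ =>
  ((Complex.differentiableOn_dslope univ_mem).mpr hf.differentiableOn).differentiableAt univ_mem

/-- At a zero z of g both functions are w - z times their `dslope`. The common factor cancels, and
simplicity keeps the new denominator nonzero. -/
theorem differentiableAt_regularQuotient {f g : ℂ → ℂ} (hf : Differentiable ℂ f)
    (hg : Differentiable ℂ g) {z : ℂ} (h0 : g z = 0 → f z = 0) (h1 : g z = 0 → deriv g z ≠ 0) :
    DifferentiableAt ℂ (regularQuotient f g) z := by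
  by_cases hz : g z = 0
  · have hF := differentiable_dslope hf z
    have hG := differentiable_dslope hg z
    have hGz : dslope g z z ≠ 0 := by rw [dslope_same]; exact h1 hz
    refine ((hF z).div (hG z) hGz).congr_of_eventuallyEq ?_
    filter_upwards [(hG.continuous.continuousAt (x := z)).eventually_ne hGz] with w hw
    rcases eq_or_ne w z with rfl | hwz
    · simp [regularQuotient, hz]
    · have hgw : g w = (w - z) * dslope g z w := by
        have := sub_smul_dslope g z w
        rw [hz, sub_zero] at this
        exact this.symm
      have hfw : f w = (w - z) * dslope f z w := by
        have := sub_smul_dslope f z w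
        rw [h0 hz, sub_zero] at this
        exact this.symm
      have hwz' := sub_ne_zero.mpr hwz
      have hgw0 : g w ≠ 0 := by rw [hgw]; exact mul_ne_zero hwz' hw
      rw [regularQuotient, if_neg hgw0, Pi.div_apply, hgw, hfw, mul_div_mul_left _ _ hwz']
  · refine ((hf z).div (hg z) hz).congr_of_eventuallyEq ?_
    filter_upwards [(hg.continuous.continuousAt (x := z)).eventually_ne hz] with w hw
    rw [regularQuotient, if_neg hw, Pi.div_apply]

theorem mul_regularQuotient {f g : ℂ → ℂ} {z : ℂ} (h0 : g z = 0 → f z = 0) :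
    g z * regularQuotient f g z = f z := by
  rw [regularQuotient]
  split_ifs with h
  · rw [h, h0 h, zero_mul]
  · rw [mul_div_cancel₀ _ h]

/-- Phragmén–Lindelöf for a quotient of entire functions. -/
theorem norm_regularQuotient_le_one {f g : ℂ → ℂ} (hf : Differentiable ℂ f)
    (hg : Differentiable ℂ g) (h0 : ∀ z : ℂ, 0 ≤ z.im → g z = 0 → f z = 0)
    (h1 : ∀ z : ℂ, 0 ≤ z.im → g z = 0 → deriv g z ≠ 0)
    (hre : ∀ x : ℝ, x ≠ 0 → ‖f x‖ = ‖g x‖) (hg0 : ∀ x : ℝ, x ≠ 0 → g x ≠ 0) {C R : ℝ}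
    (hC : ∀ z : ℂ, 0 ≤ z.im → R ≤ ‖z‖ → g z ≠ 0 ∧ ‖f z‖ ≤ C * ‖g z‖) {z : ℂ} (hz : 0 ≤ z.im) :
    ‖regularQuotient f g z‖ ≤ 1 := by
  set h := regularQuotient f g
  have hd : ∀ z : ℂ, 0 ≤ z.im → DifferentiableAt ℂ h z := fun z hz =>
    differentiableAt_regularQuotient hf hg (h0 z hz) (h1 z hz)
  have hr : ∀ x : ℝ, x ≠ 0 → ‖h x‖ = 1 := fun x hx => by
    have hgx := hg0 x hx
    simp only [h, regularQuotient, if_neg hgx, norm_div, hre x hx]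
    exact div_self (norm_ne_zero_iff.mpr hgx)
  -- The boundary values are known off the origin; the bound at 0 follows by continuity.
  have hr0 : ∀ x : ℝ, ‖h x‖ ≤ 1 := fun x => by
    rcases eq_or_ne x 0 with rfl | hx
    · have hc : ContinuousAt (fun x : ℝ => ‖h x‖) 0 := by
        have : ContinuousAt h ((0 : ℝ) : ℂ) := (hd _ (by simp)).continuousAt
        exact (this.comp (f := fun x : ℝ => (x : ℂ)) Complex.continuous_ofReal.continuousAt).norm
      have h2 : Tendsto (fun x : ℝ => ‖h x‖) (𝓝[≠] 0) (𝓝 ‖h (0 : ℝ)‖) :=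
        hc.tendsto.mono_left nhdsWithin_le_nhds
      refine le_of_tendsto h2 ?_
      filter_upwards [self_mem_nhdsWithin] with x hx using (hr x hx).le
    · exact (hr x hx).le
  obtain ⟨B, hB⟩ : ∃ B, ∀ z : ℂ, 0 ≤ z.im → ‖h z‖ ≤ B := by
    have hK : IsCompact (Metric.closedBall (0 : ℂ) (max R 1) ∩ {z : ℂ | 0 ≤ z.im}) :=
      (isCompact_closedBall _ _).inter_right (isClosed_le continuous_const Complex.continuous_im)
    obtain ⟨B, hB⟩ := hK.exists_bound_of_continuousOn (f := h)
      fun z hz => (hd z hz.2).continuousAt.continuousWithinAt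
    refine ⟨max B (max C 0), fun z hz => ?_⟩
    rcases le_total ‖z‖ (max R 1) with hzR | hzR
    · exact (hB z ⟨by simpa using hzR, hz⟩).trans (le_max_left _ _)
    · refine le_trans ?_ (le_max_right _ _)
      obtain ⟨hgz, h3⟩ := hC z hz ((le_max_left _ _).trans hzR)
      simp only [h, regularQuotient, if_neg hgz, norm_div]
      rw [div_le_iff₀ (norm_pos_iff.mpr hgz)]
      exact h3.trans (mul_le_mul_of_nonneg_right (le_max_left _ _) (norm_nonneg _))
  have him : ∀ w : ℂ, (Complex.I * w).im = w.re := fun w => by simp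
  have hdk : ∀ w : ℂ, 0 ≤ w.re → DifferentiableAt ℂ (fun w => h (Complex.I * w)) w := fun w hw =>
    (hd _ (by rwa [him])).comp w (differentiableAt_id.const_mul Complex.I)
  -- The map w ↦ iw carries the right half-plane to the upper one. As h is bounded, the growth
  -- condition holds trivially, with exponent 1 and constant 0.
  have key := PhragmenLindelof.right_half_plane_of_bounded_on_real
    (f := fun w => h (Complex.I * w)) (C := 1) (z := -Complex.I * z)
    ⟨fun w hw => (hdk w (le_of_lt hw)).differentiableWithinAt, fun w hw => by
      rw [Complex.closure_setOfPred_lt_re] at hw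
      exact (hdk w hw).continuousAt.continuousWithinAt⟩
    ⟨1, by norm_num, 0, by
      refine Asymptotics.IsBigO.of_bound B (eventually_inf_principal.mpr
        (Eventually.of_forall fun w hw => ?_))
      simpa using hB (Complex.I * w) (by rw [him]; exact le_of_lt hw)⟩
    ⟨B, eventually_map.mpr ((eventually_ge_atTop 0).mono fun x hx =>
      hB _ (by rw [him]; exact hx))⟩
    (fun x => by
      have : Complex.I * (x * Complex.I) = ((-x : ℝ) : ℂ) := by
        push_cast; linear_combination (x : ℂ) * Complex.I_sq
      rw [this]; exact hr0 _) (by simpa using hz)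
  have hz' : Complex.I * (-Complex.I * z) = z := by linear_combination (-z) * Complex.I_sq
  simpa only [hz'] using key

/-- Both f/g and g/f are bounded by one, so f/g attains its maximal modulus at an interior point and
is constant in the half-plane. The identity theorem extends the relation to the plane. -/
theorem exists_eq_const_mul {f g : ℂ → ℂ} (hf : Differentiable ℂ f)
    (hg : Differentiable ℂ g) (h0 : ∀ z : ℂ, 0 ≤ z.im → (f z = 0 ↔ g z = 0))
    (hf1 : ∀ z : ℂ, 0 ≤ z.im → f z = 0 → deriv f z ≠ 0)
    (hg1 : ∀ z : ℂ, 0 ≤ z.im → g z = 0 → deriv g z ≠ 0)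
    (hre : ∀ x : ℝ, x ≠ 0 → ‖f x‖ = ‖g x‖) (hg0 : ∀ x : ℝ, x ≠ 0 → g x ≠ 0) {C R : ℝ}
    (hC : ∀ z : ℂ, 0 ≤ z.im → R ≤ ‖z‖ → g z ≠ 0 ∧ ‖f z‖ ≤ C * ‖g z‖ ∧ ‖g z‖ ≤ C * ‖f z‖) :
    ∃ c : ℂ, ∀ z, f z = c * g z := by
  have hf0 : ∀ x : ℝ, x ≠ 0 → f x ≠ 0 := fun x hx h => hg0 x hx ((h0 x (by simp)).mp h)
  have hfg := fun z hz => norm_regularQuotient_le_one hf hg (fun z hz => (h0 z hz).mpr) hg1 hre hg0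
    (fun z hz hR => ⟨(hC z hz hR).1, (hC z hz hR).2.1⟩) (z := z) hz
  have hgf := fun z hz => norm_regularQuotient_le_one hg hf (fun z hz => (h0 z hz).mp) hf1
    (fun x hx => (hre x hx).symm) hf0
    (fun z hz hR => ⟨fun h => (hC z hz hR).1 ((h0 z hz).mp h), (hC z hz hR).2.2⟩) (z := z) hz
  set z₀ : ℂ := Complex.I * (max R 1 : ℝ) with hz₀
  have hz₀im : 0 < z₀.im := by simp [hz₀]
  have hgz₀ : g z₀ ≠ 0 := (hC z₀ hz₀im.le (by simp [hz₀, abs_of_pos])).1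
  have hfz₀ : f z₀ ≠ 0 := fun h => hgz₀ ((h0 z₀ hz₀im.le).mp h)
  have hone : ‖regularQuotient f g z₀‖ = 1 := by
    refine le_antisymm (hfg z₀ hz₀im.le) ?_
    have := hgf z₀ hz₀im.le
    rw [regularQuotient, if_neg hfz₀, norm_div, div_le_one (norm_pos_iff.mpr hfz₀)] at this
    rw [regularQuotient, if_neg hgz₀, norm_div, one_le_div (norm_pos_iff.mpr hgz₀)]
    exact this
  have hU : IsOpen {z : ℂ | 0 < z.im} := isOpen_lt continuous_const Complex.continuous_im
  have hconst := Complex.eqOn_of_isPreconnected_of_isMaxOn_norm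
    (f := regularQuotient f g) (U := {z : ℂ | 0 < z.im}) (c := z₀)
    (convex_halfSpace_im_gt 0).isPreconnected hU
    (fun z hz => (differentiableAt_regularQuotient hf hg (h0 z (le_of_lt hz)).mpr
      (hg1 z (le_of_lt hz))).differentiableWithinAt) hz₀im
    (fun z hz => by
      simp only [Set.mem_ofPred_eq, Function.comp_apply, hone]
      exact hfg z (le_of_lt hz))
  refine ⟨regularQuotient f g z₀, fun z => ?_⟩
  have han1 : AnalyticOnNhd ℂ f Set.univ := fun z _ => hf.analyticAt z
  have han2 : AnalyticOnNhd ℂ (fun z => regularQuotient f g z₀ * g z) Set.univ := fun z _ =>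
    (hg.const_mul _).analyticAt z
  have heq : f =ᶠ[𝓝 z₀] fun z => regularQuotient f g z₀ * g z := by
    filter_upwards [hU.mem_nhds hz₀im] with z hz
    have h3 := hconst hz
    simp only [Function.const_apply] at h3
    rw [← h3, mul_comm, mul_regularQuotient (h0 z (le_of_lt hz)).mpr]
  exact han1.eqOn_of_preconnected_of_eventuallyEq han2 isPreconnected_univ (Set.mem_univ z₀) heq
    (Set.mem_univ z)

/-! ### The scattering data determine the monodromy matrix up to sign -/

theorem le_of_forall_mul_pow_le {n m : ℕ} {c C R : ℝ} (hc : 0 < c)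
    (h : ∀ x : ℝ, R ≤ x → c * x ^ n ≤ C * x ^ m) : n ≤ m := by
  by_contra! hmn
  set x := max (max R 1) (C / c + 1) with hx
  have hx1 : 1 ≤ x := (le_max_right _ _).trans (le_max_left _ _)
  have hxC : C / c < x := lt_of_lt_of_le (lt_add_one _) (le_max_right _ _)
  have h1 := h x ((le_max_left _ _).trans (le_max_left _ _))
  have h2 : x ^ (m + 1) ≤ x ^ n := pow_le_pow_right₀ hx1 hmn
  rw [div_lt_iff₀ hc] at hxC
  have h3 : 0 < x ^ m := by positivity
  rw [pow_succ] at h2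
  nlinarith [mul_le_mul_of_nonneg_left h2 hc.le, mul_lt_mul_of_pos_right hxC h3]

section Uniqueness

variable {q₁ q₂ : ℝ → ℝ} {M₁ M₂ : Matrix (Fin 2) (Fin 2) ℝ} {S : ℝ}
  (F₁ : FundamentalSystem q₁ M₁ S) (F₂ : FundamentalSystem q₂ M₂ S)

namespace FundamentalSystem

/-- Unitarity reads |P|² (1 - |Q/P|²) = 4ξ², so the quotient Q/P determines |P|. -/
theorem norm_P_eq (hq₁ : LocallyIntegrable q₁ volume) (hq₂ : LocallyIntegrable q₂ volume)
    (hM₁ : M₁.det = 1) (hM₂ : M₂.det = 1)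
    (hQP : ∀ ξ : ℝ, ξ ≠ 0 → F₁.Q ξ * F₂.P ξ = F₂.Q ξ * F₁.P ξ) (ξ : ℝ) (hξ : ξ ≠ 0) :
    ‖F₁.P ξ‖ = ‖F₂.P ξ‖ := by
  have h1 := F₁.norm_P_sq_sub_norm_Q_sq hq₁ hM₁ ξ
  have h2 := F₂.norm_P_sq_sub_norm_Q_sq hq₂ hM₂ ξ
  have h3 := congrArg (fun w => ‖w‖ ^ 2) (hQP ξ hξ)
  simp only [norm_mul, mul_pow] at h3
  have h4 : 0 < 4 * ξ ^ 2 := by positivity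
  have h5 : 4 * ξ ^ 2 * (‖F₁.P ξ‖ ^ 2 - ‖F₂.P ξ‖ ^ 2) = 0 := by
    linear_combination ‖F₂.P ξ‖ ^ 2 * h1 - ‖F₁.P ξ‖ ^ 2 * h2 + h3
  have h6 : ‖F₁.P ξ‖ ^ 2 = ‖F₂.P ξ‖ ^ 2 := by
    linarith [(mul_eq_zero.mp h5).resolve_left h4.ne']
  exact (sq_eq_sq₀ (norm_nonneg _) (norm_nonneg _)).mp h6

theorem exists_P_eq_const_mul (hS : 0 ≤ S) (hq₁ : LocallyIntegrable q₁ volume)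
    (hq₂ : LocallyIntegrable q₂ volume) (hM₁ : M₁.det = 1) (hM₂ : M₂.det = 1)
    (hQP : ∀ ξ : ℝ, ξ ≠ 0 → F₁.Q ξ * F₂.P ξ = F₂.Q ξ * F₁.P ξ)
    (hzero : ∀ ζ : ℂ, 0 < ζ.im → (F₁.P ζ = 0 ↔ F₂.P ζ = 0)) :
    ∃ k : ℂ, ∀ ζ, F₁.P ζ = k * F₂.P ζ := by
  have hnorm := F₁.norm_P_eq F₂ hq₁ hq₂ hM₁ hM₂ hQP
  -- The origin is the one possible zero in the closed half-plane that `hzero` does not cover;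
  -- continuity of |P| shows that it is a zero of both functions or of neither.
  have hnorm0 : ‖F₁.P ((0 : ℝ) : ℂ)‖ = ‖F₂.P ((0 : ℝ) : ℂ)‖ := by
    have hc₁ : Continuous fun x : ℝ => ‖F₁.P x‖ :=
      (F₁.differentiable_P.continuous.comp Complex.continuous_ofReal).norm
    have hc₂ : Continuous fun x : ℝ => ‖F₂.P x‖ :=
      (F₂.differentiable_P.continuous.comp Complex.continuous_ofReal).norm
    refine tendsto_nhds_unique
      ((hc₁.tendsto 0).mono_left (nhdsWithin_le_nhds (s := {0}ᶜ)))
      (((hc₂.tendsto 0).mono_left nhdsWithin_le_nhds).congr' ?_)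
    filter_upwards [self_mem_nhdsWithin] with x hx using (hnorm x hx).symm
  obtain ⟨n₁, c₁, C₁, R₁, hc₁, hC₁, hg₁⟩ := F₁.exists_P_growth hq₁ hM₁ hS
  obtain ⟨n₂, c₂, C₂, R₂, hc₂, hC₂, hg₂⟩ := F₂.exists_P_growth hq₂ hM₂ hS
  let E : ℂ → ℝ := fun ζ => ‖2 * (Complex.I * ζ) * Complex.exp (-(2 * (Complex.I * ζ * S)))‖
  have hE : ∀ ζ : ℂ, ζ ≠ 0 → 0 < E ζ := fun ζ hζ => norm_pos_iff.mpr
    (mul_ne_zero (mul_ne_zero two_ne_zero (mul_ne_zero Complex.I_ne_zero hζ))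
      (Complex.exp_ne_zero _))
  -- The growth exponents are not assumed equal; equality of |P| on the real axis forces it.
  have hcmp : ∀ x : ℝ, max (max R₁ R₂) 1 ≤ x →
      c₁ * x ^ n₁ ≤ C₂ * x ^ n₂ ∧ c₂ * x ^ n₂ ≤ C₁ * x ^ n₁ := fun x hx => by
    have hx1 : 1 ≤ x := (le_max_right _ _).trans hx
    have hnx : ‖(x : ℂ)‖ = x := by
      rw [Complex.norm_real, Real.norm_eq_abs, abs_of_nonneg (by linarith)]
    have hEx : 0 < E x := hE x (by exact_mod_cast (by linarith : x ≠ 0))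
    have h1 := hg₁ x (by simp) (by
      rw [hnx]; exact (le_max_left _ _).trans ((le_max_left _ _).trans hx))
    have h2 := hg₂ x (by simp) (by
      rw [hnx]; exact (le_max_right _ _).trans ((le_max_left _ _).trans hx))
    rw [hnx] at h1 h2
    have h3 := hnorm x (by linarith)
    constructor
    · exact le_of_mul_le_mul_right (h1.1.trans (h3.le.trans h2.2)) hEx
    · exact le_of_mul_le_mul_right (h2.1.trans (h3.ge.trans h1.2)) hEx
  have hn : n₁ = n₂ := le_antisymm (le_of_forall_mul_pow_le hc₁ fun x hx => (hcmp x hx).1)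
    (le_of_forall_mul_pow_le hc₂ fun x hx => (hcmp x hx).2)
  subst hn
  refine exists_eq_const_mul (C := C₁ / c₂ + C₂ / c₁) (R := max (max R₁ R₂) 1)
    F₁.differentiable_P F₂.differentiable_P
    (fun z hz => ?_) (fun z hz h => F₁.deriv_P_ne_zero hq₁ hM₁ hS hz h)
    (fun z hz h => F₂.deriv_P_ne_zero hq₂ hM₂ hS hz h) hnorm
    (fun x hx => F₂.P_ofReal_ne_zero hq₂ hM₂ hS hx) fun z hz hR => ?_
  · rcases hz.lt_or_eq with hz' | hz'
    · exact hzero z hz'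
    · obtain ⟨x, rfl⟩ : ∃ x : ℝ, z = x := ⟨z.re, Complex.ext rfl (by simp [← hz'])⟩
      rcases eq_or_ne x 0 with rfl | hx
      · rw [← norm_eq_zero, hnorm0, norm_eq_zero]
      · rw [← norm_eq_zero, hnorm x hx, norm_eq_zero]
  · have hz1 : 1 ≤ ‖z‖ := (le_max_right _ _).trans hR
    have hz0 : z ≠ 0 := norm_pos_iff.mp (by linarith)
    have hEz := hE z hz0
    obtain ⟨a1, a2⟩ := hg₁ z hz ((le_max_left _ _).trans ((le_max_left _ _).trans hR))
    obtain ⟨b1, b2⟩ := hg₂ z hz ((le_max_right _ _).trans ((le_max_left _ _).trans hR))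
    have hX : 0 < ‖z‖ ^ n₁ * E z := by positivity
    rw [mul_assoc] at a1 a2 b1 b2
    change c₁ * (‖z‖ ^ n₁ * E z) ≤ _ at a1
    change _ ≤ C₁ * (‖z‖ ^ n₁ * E z) at a2
    change c₂ * (‖z‖ ^ n₁ * E z) ≤ _ at b1
    change _ ≤ C₂ * (‖z‖ ^ n₁ * E z) at b2
    refine ⟨norm_pos_iff.mp (lt_of_lt_of_le (by positivity) b1), ?_, ?_⟩
    · have h1 : C₁ * (‖z‖ ^ n₁ * E z) ≤ C₁ / c₂ * ‖F₂.P z‖ := by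
        rw [div_mul_eq_mul_div, le_div_iff₀ hc₂]
        linarith [mul_le_mul_of_nonneg_left b1 hC₁.le]
      have h2 : 0 ≤ C₂ / c₁ * ‖F₂.P z‖ := by positivity
      rw [add_mul]; linarith
    · have h1 : C₂ * (‖z‖ ^ n₁ * E z) ≤ C₂ / c₁ * ‖F₁.P z‖ := by
        rw [div_mul_eq_mul_div, le_div_iff₀ hc₁]
        linarith [mul_le_mul_of_nonneg_left a1 hC₂.le]
      have h2 : 0 ≤ C₁ / c₂ * ‖F₁.P z‖ := by positivity
      rw [add_mul]; linarith

/-- The squares of nonzero reals accumulate at 0, so the identity theorem applies there. -/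
theorem eq_const_mul_of_pos {f g : ℂ → ℂ} (hf : Differentiable ℂ f) (hg : Differentiable ℂ g)
    {k : ℂ} (h : ∀ ξ : ℝ, ξ ≠ 0 → f ((ξ : ℂ) ^ 2) = k * g ((ξ : ℂ) ^ 2)) (lam : ℂ) :
    f lam = k * g lam := by
  have han1 : AnalyticOnNhd ℂ f Set.univ := fun z _ => hf.analyticAt z
  have han2 : AnalyticOnNhd ℂ (fun z => k * g z) Set.univ := fun z _ =>
    (hg.const_mul _).analyticAt z
  refine congrFun (han1.eq_of_frequently_eq (z₀ := 0) han2 ?_) lam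
  have ht : Tendsto (fun ξ : ℝ => (ξ : ℂ) ^ 2) (𝓝[≠] 0) (𝓝[≠] 0) := by
    refine tendsto_nhdsWithin_iff.mpr ⟨?_, ?_⟩
    · have : Continuous fun ξ : ℝ => (ξ : ℂ) ^ 2 := by fun_prop
      exact (this.tendsto' 0 0 (by simp)).mono_left nhdsWithin_le_nhds
    · filter_upwards [self_mem_nhdsWithin] with ξ hξ
      exact pow_ne_zero 2 (Complex.ofReal_ne_zero.mpr hξ)
  refine ht.frequently (Eventually.frequently ?_)
  filter_upwards [self_mem_nhdsWithin] with ξ hξ using h ξ hξ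

theorem exists_sign (hS : 0 ≤ S) (hq₁ : LocallyIntegrable q₁ volume)
    (hq₂ : LocallyIntegrable q₂ volume) (hM₁ : M₁.det = 1) (hM₂ : M₂.det = 1)
    (hQP : ∀ ξ : ℝ, ξ ≠ 0 → F₁.Q ξ * F₂.P ξ = F₂.Q ξ * F₁.P ξ)
    (hzero : ∀ ζ : ℂ, 0 < ζ.im → (F₁.P ζ = 0 ↔ F₂.P ζ = 0)) :
    ∃ k : ℂ, k ^ 2 = 1 ∧ ∀ lam, F₁.zc lam S = k * F₂.zc lam S ∧
      F₁.dzc lam S = k * F₂.dzc lam S := by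
  obtain ⟨k, hk⟩ := F₁.exists_P_eq_const_mul F₂ hS hq₁ hq₂ hM₁ hM₂ hQP hzero
  have hQ : ∀ ξ : ℝ, ξ ≠ 0 → F₁.Q ξ = k * F₂.Q ξ := fun ξ hξ => by
    have h1 := hQP ξ hξ
    rw [hk] at h1
    refine mul_right_cancel₀ (F₂.P_ofReal_ne_zero hq₂ hM₂ hS hξ) ?_
    linear_combination h1
  have hz : ∀ ξ : ℝ, ξ ≠ 0 → F₁.zj ξ S = k * F₂.zj ξ S ∧ F₁.dzj ξ S = k * F₂.dzj ξ S :=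
    fun ξ hξ => by
      have h1 := hk ξ
      have h2 := hQ ξ hξ
      simp only [P, Q] at h1 h2
      have h3 : 2 * (Complex.I * (ξ : ℂ)) ≠ 0 :=
        mul_ne_zero two_ne_zero (mul_ne_zero Complex.I_ne_zero (Complex.ofReal_ne_zero.mpr hξ))
      refine ⟨mul_left_cancel₀ h3 (by linear_combination h1 + h2), by
        linear_combination (h2 - h1) / 2⟩
  -- The data at S have the form c(ξ²) - iξ s(ξ²), so sums and differences of the relations at ξ and
  -- -ξ separate the entries of the monodromy matrix.
  have hall : ∀ ξ : ℝ, ξ ≠ 0 →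
      (F₁.zc ((ξ : ℂ) ^ 2) S = k * F₂.zc ((ξ : ℂ) ^ 2) S ∧
        F₁.dzc ((ξ : ℂ) ^ 2) S = k * F₂.dzc ((ξ : ℂ) ^ 2) S) ∧
      F₁.zs ((ξ : ℂ) ^ 2) S = k * F₂.zs ((ξ : ℂ) ^ 2) S ∧
        F₁.dzs ((ξ : ℂ) ^ 2) S = k * F₂.dzs ((ξ : ℂ) ^ 2) S := fun ξ hξ => by
    obtain ⟨a1, a2⟩ := hz ξ hξ
    obtain ⟨b1, b2⟩ := hz (-ξ) (neg_ne_zero.mpr hξ)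
    simp only [zj, dzj, Complex.ofReal_neg, neg_sq] at a1 a2 b1 b2
    have h3 : 2 * (Complex.I * (ξ : ℂ)) ≠ 0 :=
      mul_ne_zero two_ne_zero (mul_ne_zero Complex.I_ne_zero (Complex.ofReal_ne_zero.mpr hξ))
    refine ⟨⟨by linear_combination (a1 + b1) / 2, by linear_combination (a2 + b2) / 2⟩,
      mul_left_cancel₀ h3 (by linear_combination b1 - a1),
      mul_left_cancel₀ h3 (by linear_combination b2 - a2)⟩
  have e1 := eq_const_mul_of_pos F₁.differentiable_zc F₂.differentiable_zc
    fun ξ hξ => (hall ξ hξ).1.1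
  have e2 := eq_const_mul_of_pos F₁.differentiable_dzc F₂.differentiable_dzc
    fun ξ hξ => (hall ξ hξ).1.2
  -- Comparing the two determinants, both one, at any single parameter value gives k² = 1.
  obtain ⟨⟨h1, h2⟩, h3, h4⟩ := hall 1 one_ne_zero
  have d1 := F₁.det_eq_one hq₁ hM₁ (((1 : ℝ) : ℂ) ^ 2)
  have d2 := F₂.det_eq_one hq₂ hM₂ (((1 : ℝ) : ℂ) ^ 2)
  rw [h1, h2, h3, h4] at d1
  exact ⟨k, by linear_combination d1 - k ^ 2 * d2, fun lam => ⟨e1 lam, e2 lam⟩⟩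

end FundamentalSystem

end Uniqueness

/-! ### Spectra and norming constants on the interval -/

namespace FundamentalSystem

variable {q : ℝ → ℝ} {M : Matrix (Fin 2) (Fin 2) ℝ} {S : ℝ} (F : FundamentalSystem q M S)

/-- The Neumann condition at -S makes every eigenfunction a multiple of `yc`, `zc`, so only the
boundary condition at S remains to be tested. -/
theorem mem_intervalSpectrum_iff (hq : LocallyIntegrable q volume) (hS : 0 < S) (β : ℝ)
    (lam : ℂ) : lam ∈ intervalSpectrum q M S (Real.pi / 2) β ↔
      F.zc lam S * (Real.cos β : ℂ) - F.dzc lam S * (Real.sin β : ℂ) = 0 := by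
  have hl : -S ∈ Set.Icc (-S) S := ⟨le_rfl, by linarith⟩
  have hr : S ∈ Set.Icc (-S) S := ⟨by linarith, le_rfl⟩
  constructor
  · rintro ⟨y, dy, hy, h1, h2, x, hx, hx0, hyx⟩
    have hdy : dy (-S) = 0 := by simpa using h1
    have hm := (F.pair_c lam).lincomb (F.pair_c lam) (y (-S)) 0
    simp only [zero_mul, add_zero] at hm
    obtain ⟨hL, hR⟩ := hy.eq_matchedPair hq hS hl hr hm
      (by rw [F.yc_left, mul_one]) (by rw [F.dyc_left, hdy, mul_zero])
    have hy0 : y (-S) ≠ 0 := fun h0 => hyx (by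
      rcases lt_or_gt_of_ne hx0 with h | h
      · rw [(hL x hx h).1, h0, zero_mul]
      · rw [(hR x hx h).1, h0, zero_mul])
    rw [(hR S hr hS).1, (hR S hr hS).2] at h2
    refine (mul_eq_zero.mp (?_ : y (-S) * _ = 0)).resolve_left hy0
    linear_combination h2
  · intro h
    have hneg : -S < 0 := by linarith
    refine ⟨_, _, (F.pair_c lam).isTransferSolution _, ?_, ?_, -S, hl, hneg.ne, ?_⟩
    · simp only [if_pos hneg, F.dyc_left]; simp
    · simp only [if_neg (not_lt.mpr hS.le)]; exact h
    · simp [hneg, F.yc_left]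

theorem mem_neumannNeumannSpectrum_iff (hq : LocallyIntegrable q volume) (hS : 0 < S) (lam : ℂ) :
    lam ∈ neumannNeumannSpectrum q M S ↔ F.dzc lam S = 0 := by
  rw [neumannNeumannSpectrum, F.mem_intervalSpectrum_iff hq hS]; simp

theorem mem_neumannDirichletSpectrum_iff (hq : LocallyIntegrable q volume) (hS : 0 < S)
    (lam : ℂ) : lam ∈ neumannDirichletSpectrum q M S ↔ F.zc lam S = 0 := by
  rw [neumannDirichletSpectrum, F.mem_intervalSpectrum_iff hq hS]; simp

/-- The integral over `[-S, S]` of the product of the Neumann solutions for `lam` and `mu`. -/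
noncomputable def neumannOverlap (lam mu : ℂ) : ℂ :=
  (∫ x in (-S)..0, F.yc lam x * F.yc mu x) + ∫ x in (0 : ℝ)..S, F.zc lam x * F.zc mu x

theorem continuous_neumannOverlap (lam : ℂ) : Continuous fun mu => F.neumannOverlap lam mu := by
  refine Continuous.add ?_ ?_
  · refine intervalIntegral.continuous_parametric_intervalIntegral_of_continuous' ?_ _ _
    have h := F.continuous_yc
    exact (h.comp (continuous_const.prodMk continuous_snd)).mul h
  · refine intervalIntegral.continuous_parametric_intervalIntegral_of_continuous' ?_ _ _
    have h := F.continuous_zc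
    exact (h.comp (continuous_const.prodMk continuous_snd)).mul h

theorem mul_neumannOverlap (hq : LocallyIntegrable q volume) (hM : M.det = 1) (lam mu : ℂ) :
    (lam - mu) * F.neumannOverlap lam mu =
      F.zc lam S * F.dzc mu S - F.dzc lam S * F.zc mu S := by
  have h := (F.pair_c lam).wronskian hq hM (F.pair_c mu) (-S) S
  rw [F.yc_left, F.yc_left, F.dyc_left, F.dyc_left] at h
  rw [neumannOverlap, ← h]; ring

theorem isNormingConstant_iff (hq : LocallyIntegrable q volume) (hS : 0 < S) (lam a : ℂ) :
    IsNormingConstant q M S (Real.pi / 2) lam a ↔ a = F.neumannOverlap lam lam := by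
  have hl : -S ∈ Set.Icc (-S) S := ⟨le_rfl, by linarith⟩
  have hr : S ∈ Set.Icc (-S) S := ⟨by linarith, le_rfl⟩
  have hneg : -S < 0 := by linarith
  have hcy := (F.pair_c lam).left.continuous
  have hcz := (F.pair_c lam).right.continuous
  have key : ∀ w : ℝ → ℂ, (∀ x ∈ Set.Icc (-S) S, x < 0 → w x = F.yc lam x) →
      (∀ x ∈ Set.Icc (-S) S, 0 < x → w x = F.zc lam x) →
      ∫ x in (-S)..S, w x ^ 2 = F.neumannOverlap lam lam := fun w h1 h2 => by
    have e1 : ∀ᵐ x : ℝ, x ∈ Set.uIoc (-S) 0 → F.yc lam x * F.yc lam x = w x ^ 2 := by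
      filter_upwards [ae_ne_real 0] with x hx hxI
      rw [Set.uIoc_of_le hneg.le] at hxI
      rw [h1 x ⟨hxI.1.le, hxI.2.trans hS.le⟩ (lt_of_le_of_ne hxI.2 hx), sq]
    have e2 : ∀ᵐ x : ℝ, x ∈ Set.uIoc 0 S → F.zc lam x * F.zc lam x = w x ^ 2 := by
      filter_upwards with x hxI
      rw [Set.uIoc_of_le hS.le] at hxI
      rw [h2 x ⟨hneg.le.trans hxI.1.le, hxI.2⟩ hxI.1, sq]
    have i1 : IntervalIntegrable (fun x => F.yc lam x * F.yc lam x) volume (-S) 0 :=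
      (hcy.mul hcy).intervalIntegrable _ _
    have i2 : IntervalIntegrable (fun x => F.zc lam x * F.zc lam x) volume 0 S :=
      (hcz.mul hcz).intervalIntegrable _ _
    rw [neumannOverlap, intervalIntegral.integral_congr_ae e1,
      intervalIntegral.integral_congr_ae e2]
    exact (intervalIntegral.integral_add_adjacent_intervals
      (i1.congr_ae ((ae_restrict_iff' measurableSet_uIoc).mpr e1))
      (i2.congr_ae ((ae_restrict_iff' measurableSet_uIoc).mpr e2))).symm
  constructor
  · rintro ⟨w, dw, hw, hw1, hw2, rfl⟩
    obtain ⟨hL, hR⟩ := hw.eq_matchedPair hq hS hl hr (F.pair_c lam)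
      (by rw [F.yc_left, hw1]; simp) (by rw [F.dyc_left, hw2]; simp)
    exact key w (fun x hx h => (hL x hx h).1) fun x hx h => (hR x hx h).1
  · rintro rfl
    refine ⟨_, _, (F.pair_c lam).isTransferSolution _, ?_, ?_, (key _ ?_ ?_).symm⟩
    · simp [hneg, F.yc_left]
    · simp [hneg, F.dyc_left]
    · exact fun x _ hx => if_pos hx
    · exact fun x _ hx => if_neg (not_lt.mpr hx.le)

theorem neumannNeumannNormingConstant_eq (hq : LocallyIntegrable q volume) (hS : 0 < S)
    (lam : ℂ) : neumannNeumannNormingConstant q M S lam = F.neumannOverlap lam lam := by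
  have hex : ∃ a : ℂ, IsNormingConstant q M S (Real.pi / 2) lam a :=
    ⟨_, (F.isNormingConstant_iff hq hS lam _).mpr rfl⟩
  rw [neumannNeumannNormingConstant, normingConstant, dif_pos hex]
  exact (F.isNormingConstant_iff hq hS lam _).mp hex.choose_spec

end FundamentalSystem

end TransferSL

/-! ### Determination of the interval data -/

open TransferSL in
theorem theorem4p6 (S : ℝ) (hS : 0 < S)
    (q₁ q₂ : ℝ → ℝ) (M₁ M₂ : Matrix (Fin 2) (Fin 2) ℝ)
    (hq₁ : MemLp q₁ 2 volume) (hq₂ : MemLp q₂ 2 volume)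
    (hsupp₁ : ∀ᵐ x : ℝ, x ∉ Set.Icc (-S) S → q₁ x = 0)
    (hsupp₂ : ∀ᵐ x : ℝ, x ∉ Set.Icc (-S) S → q₂ x = 0)
    (hM₁ : M₁.det = 1) (hM₂ : M₂.det = 1)
    (hR : ∀ ξ : ℝ, ξ ≠ 0 → reflectionCoeff q₁ M₁ ξ = reflectionCoeff q₂ M₂ ξ)
    (hE : lineEigenvalues q₁ M₁ = lineEigenvalues q₂ M₂) :
    neumannNeumannSpectrum q₁ M₁ S = neumannNeumannSpectrum q₂ M₂ S ∧
    neumannDirichletSpectrum q₁ M₁ S = neumannDirichletSpectrum q₂ M₂ S ∧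
    ∀ lam ∈ neumannNeumannSpectrum q₁ M₁ S,
      neumannNeumannNormingConstant q₁ M₁ S lam =
        neumannNeumannNormingConstant q₂ M₂ S lam := by
  have hl₁ : LocallyIntegrable q₁ volume := hq₁.locallyIntegrable (by norm_num)
  have hl₂ : LocallyIntegrable q₂ volume := hq₂.locallyIntegrable (by norm_num)
  obtain ⟨F₁⟩ := nonempty_fundamentalSystem hl₁ M₁ S
  obtain ⟨F₂⟩ := nonempty_fundamentalSystem hl₂ M₂ S
  obtain ⟨k, hk, hzc⟩ := F₁.exists_sign F₂ hS.le hl₁ hl₂ hM₁ hM₂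
    (fun ξ hξ => by
      have h := hR ξ hξ
      rw [F₁.reflectionCoeff_eq hl₁ hM₁ hS hsupp₁ hξ, F₂.reflectionCoeff_eq hl₂ hM₂ hS hsupp₂ hξ]
        at h
      exact (div_eq_div_iff (F₁.P_ofReal_ne_zero hl₁ hM₁ hS.le hξ)
        (F₂.P_ofReal_ne_zero hl₂ hM₂ hS.le hξ)).mp (mul_left_cancel₀ (Complex.exp_ne_zero _) h))
    fun ζ hζ => by
      rw [← F₁.sq_mem_lineEigenvalues_iff hl₁ hS hsupp₁ hζ, hE,
        F₂.sq_mem_lineEigenvalues_iff hl₂ hS hsupp₂ hζ]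
  have hk0 : k ≠ 0 := by rintro rfl; simp at hk
  refine ⟨Set.ext fun lam => ?_, Set.ext fun lam => ?_, fun lam _ => ?_⟩
  · rw [F₁.mem_neumannNeumannSpectrum_iff hl₁ hS, F₂.mem_neumannNeumannSpectrum_iff hl₂ hS,
      (hzc lam).2, mul_eq_zero, or_iff_right hk0]
  · rw [F₁.mem_neumannDirichletSpectrum_iff hl₁ hS, F₂.mem_neumannDirichletSpectrum_iff hl₂ hS,
      (hzc lam).1, mul_eq_zero, or_iff_right hk0]
  · rw [F₁.neumannNeumannNormingConstant_eq hl₁ hS, F₂.neumannNeumannNormingConstant_eq hl₂ hS]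
    -- On the diagonal the Lagrange identity reads 0 = 0, so the norming constant is reached as a
    -- limit mu → lam. Off the diagonal its right-hand side is quadratic in the data at S, so only
    -- k² = 1 enters.
    have h1 := ((F₁.continuous_neumannOverlap lam).tendsto lam).mono_left
      (nhdsWithin_le_nhds (s := {lam}ᶜ))
    have h2 := ((F₂.continuous_neumannOverlap lam).tendsto lam).mono_left
      (nhdsWithin_le_nhds (s := {lam}ᶜ))
    refine tendsto_nhds_unique h1 (h2.congr' ?_)
    filter_upwards [self_mem_nhdsWithin] with mu hmu
    have hne : lam - mu ≠ 0 := sub_ne_zero.mpr (Ne.symm hmu)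
    refine mul_left_cancel₀ hne ?_
    rw [F₁.mul_neumannOverlap hl₁ hM₁, F₂.mul_neumannOverlap hl₂ hM₂, (hzc lam).1, (hzc lam).2,
      (hzc mu).1, (hzc mu).2]
    linear_combination (-(F₂.zc lam S * F₂.dzc mu S) + F₂.dzc lam S * F₂.zc mu S) * hk
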